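/- For $n\ge 2$ let $\Upsilon^n=\{x\in\mathbb R^n:(x_1+x_2)^2\ge 2\sum_{i\ge3}x_i^2,\ x_1\ge x_2,\ x_1+x_2\ge0\}$, and let $\Upsilon=\Upsilon^{n_1}\times\dots\times\Upsilon^{n_N}$ with interior $\Upsilon_+$. Write $x=(x^1,\dots,x^N)$ with $x^j\in\mathbb R^{n_j}$, $e^j=(1,0,\dots,0)$, $e=(e^1,\dots,e^N)$. For $x\in\mathbb R^n$ put $\bar x=(x_3,\dots,x_n)$, $\lambda_1=x_1-x_2$, $\lambda_{2}=x_1+x_2-\sqrt2\|\bar x\|$, $\lambda_{4}=x_1+x_2+\sqrt2\|\bar x\|$, $v_1=(\tfrac12,-\tfrac12,0)$, $v_{2}=(\tfrac14,\tfrac14,\tfrac{-\bar x}{2\sqrt2\|\bar x\|})$, $v_{4}=(\tfrac14,\tfrac14,\tfrac{\bar x}{2\sqrt2\|\bar x\|})$ (last entries $0$ if $\bar x=0$), so that $x=\lambda_1v_1+\lambda_2v_2+\lambda_4v_4$, and for a real function $\varphi$ let $\varphi(x)=\varphi(\lambda_1)v_1+\varphi(\lambda_2)v_2+\varphi(\lambda_4)v_4$,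 applied blockwise on the product. **Kernel.** Let $\psi:(0,\infty)\to\mathbb R$ be an eligible kernel function: three times differentiable, $\psi(1)=\psi'(1)=0$, $\psi''>0$, $\psi(t)\to\infty$ as $t\downarrow0$ and as $t\to\infty$, and (i) $t\psi''+\psi'>0$ for $t<1$; (ii) $t\psi''-\psi'>0$ for $t>1$; (iii) $\psi'''<0$; (iv) $2(\psi'')^2-\psi'\psi'''>0$ for $t<1$; (v) $\psi''(t)\psi'(\beta t)-\beta\psi'(t)\psi''(\beta t)>0$ for $t,\beta>1$. Let $\varrho:[0,\infty)\to[1,\infty)$ be the inverse of $\psi|_{[1,\infty)}$ and $\rho:[0,\infty)\to(0,1]$ the inverse of $-\tfrac12\psi'|_{(0,1]}$. Let $\Psi(v)=\sum_{j}\mathrm{Tr}(\psi(v^j))$, where $\mathrm{Tr}(x)=2x_1$, and $\delta(v)=\tfrac1{\sqrt2}\|\psi'(v)\|$. **Problem.** Let $A$ have full row rank, and consider $\min c^Tx$, $Ax=b$, $x\in\Upsilon$, with dual $\max b^Ty$, $A^Ty+s=c$, $s\in\Upsilon$. Assume $(e,y_0,e)$ is feasible: $Ae=b$, $A^Ty_0+e=c$.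 A triple $(x,y,s)$ is strictly feasible if $Ax=b$, $A^Ty+s=c$, $x,s\in\Upsilon_+$. For $x,s\in\Upsilon_+$, $\mu>0$ let $W=\mathrm{diag}(W^1,\dots,W^N)$ be the Nesterov–Todd scaling: each $W^j$ is a symmetric positive definite automorphism of $\Upsilon^{n_j}$ with $W^jx^j=(W^j)^{-1}s^j$. Put $v=Wx/\sqrt\mu$, $\Phi(x,s,\mu)=\Psi(v)$, $\bar A=AW^{-1}/\sqrt\mu$. **Algorithm** ($\tau>1$, $0<\epsilon<3N$, $0<\theta<1$). Start with $(x,y,s)=(e,y_0,e)$, $\mu=1$. While $3N\mu\ge\epsilon$: set $\mu\leftarrow(1-\theta)\mu$ and then, while $\Phi(x,s,\mu)>\tau$, perform an inner iteration $(x,y,s)\leftarrow(x+\alpha\Delta x,\,y+\alpha\Delta y,\,s+\alpha\Delta s)$, where $\bar Ad_x=0$, $\bar A^T\Delta y+d_s=0$, $d_x+d_s=-\psi'(v)$, $\Delta x=\sqrt\mu W^{-1}d_x$, $\Delta s=\sqrt\mu Wd_s$ and $\alpha=1/\psi''(\rho(2\sqrt2\,\delta(v)))$. Return $(x,y,s)$.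 **Growth condition.** Let $\kappa>0$, $\gamma\in(0,1]$ be such that for all $v\in\Upsilon_+$ with $\Psi(v)>\tau$ $$\frac{[\psi'(\varrho(2\Psi(v)))]^2}{8\,\psi''\big(\rho(\psi'(\varrho(2\Psi(v))))\big)}\ \ge\ \kappa\,\Psi(v)^{1-\gamma}.$$ **Claim.** The algorithm is well defined (all iterates are strictly feasible, the scaling exists, and the search direction exists and is unique) and terminates. It returns an $\epsilon$-accurate solution, in the sense that $(x,y,s)$ is strictly feasible and $\Phi(x,s,\mu)\le\tau$ for the final $\mu>0$, which satisfies $3N\mu<\epsilon$. With $$L=2N\,\psi\!\left(\frac{\varrho(\tau/2N)}{\sqrt{1-\theta}}\right),$$ the number of inner iterations between two successive updates of $\mu$ is at most $L^\gamma/(\kappa\gamma)$, the number of updates of $\mu$ is at most $\lceil\frac1\theta\log\frac{3N}\epsilon\rceil$, and the total number of inner iterations is at most $\frac{L^\gamma}{\kappa\gamma}\lceil\frac1\theta\log\frac{3N}\epsilon\rceil$. If moreover $\epsilon\le 3N/e^2$ (with $e=\exp(1)$), the total number of inner iterations is at most $$\frac1{\theta\kappa\gamma}\left[2N\,\psi\!\left(\frac{\varrho(\tau/2N)}{\sqrt{1-\theta}}\right)\right]^\gamma\log\frac{3N}\epsilon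 .$$ -/

import Mathlib

open Matrix

noncomputable section

namespace TypeTwoSOCO

/-! ### A single type-2 second order cone in `ℝⁿ`, `n = d + 2`

Coordinates `0`, `1` are the two distinguished coordinates `x₁`, `x₂`; the coordinates
`i.succ.succ` are the remaining ones `x₃, …, xₙ`. -/

abbrev Block (d : ℕ) := Fin (d + 2) → ℝ

/-- The Euclidean norm of `(x₃, …, xₙ)`. -/
def tailNorm {d : ℕ} (x : Block d) : ℝ := √(∑ i : Fin d, x i.succ.succ ^ 2)

/-- The type-2 second order cone
`{x | (x₁ + x₂)² ≥ 2 ∑_{i ≥ 3} xᵢ², x₁ ≥ x₂, x₁ + x₂ ≥ 0}`. -/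
def cone (d : ℕ) : Set (Block d) :=
  {x | 2 * ∑ i : Fin d, x i.succ.succ ^ 2 ≤ (x 0 + x 1) ^ 2 ∧ x 1 ≤ x 0 ∧ 0 ≤ x 0 + x 1}

def lam1 {d : ℕ} (x : Block d) : ℝ := x 0 - x 1

def lam2 {d : ℕ} (x : Block d) : ℝ := x 0 + x 1 - √2 * tailNorm x

def lam4 {d : ℕ} (x : Block d) : ℝ := x 0 + x 1 + √2 * tailNorm x

def frame1 (d : ℕ) : Block d :=
  vecCons (1 / 2) (vecCons (-1 / 2) (fun _ : Fin d => 0))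

/-- If `(x₃, …, xₙ) = 0` the quotient is `0`; then `lam2 x = lam4 x`, so only the sum
`frame2 x + frame4 x = (1/2, 1/2, 0)` enters `spectralMap`. -/
def frame2 {d : ℕ} (x : Block d) : Block d :=
  vecCons (1 / 4) (vecCons (1 / 4) (fun i : Fin d => -x i.succ.succ / (2 * √2 * tailNorm x)))

def frame4 {d : ℕ} (x : Block d) : Block d :=
  vecCons (1 / 4) (vecCons (1 / 4) (fun i : Fin d => x i.succ.succ / (2 * √2 * tailNorm x)))

/-- A real function `φ` applied to a vector through the spectral decomposition
`x = lam1 x • frame1 + lam2 x • frame2 x + lam4 x • frame4 x`. -/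
def spectralMap (φ : ℝ → ℝ) {d : ℕ} (x : Block d) : Block d :=
  φ (lam1 x) • frame1 d + φ (lam2 x) • frame2 x + φ (lam4 x) • frame4 x

/-- The trace `lam1 x + (lam2 x + lam4 x) / 2 = 2 x₁`. -/
def jordanTrace {d : ℕ} (x : Block d) : ℝ := 2 * x 0

/-! ### Products of `N` cones, the `j`-th one in `ℝ^(d j + 2)` -/

section Product

variable {N : ℕ} {d : Fin N → ℕ}

/-- The space `ℝ^(n₁) × ⋯ × ℝ^(n_N)` with `n_j = d j + 2`. -/
abbrev Vec (d : Fin N → ℕ) := (Σ j : Fin N, Fin (d j + 2)) → ℝ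

def block (x : Vec d) (j : Fin N) : Block (d j) := fun i => x ⟨j, i⟩

def productCone (d : Fin N → ℕ) : Set (Vec d) := {x | ∀ j, block x j ∈ cone (d j)}

/-- The unit element `e = (e¹, …, e^N)`, `e^j = (1, 0, …, 0)`. -/
def unitVec (d : Fin N → ℕ) : Vec d := fun p => if p.2 = 0 then 1 else 0

/-- The barrier function `Ψ(v) = ∑_j Tr(ψ(v^j))`. -/
def barrier (ψ : ℝ → ℝ) (v : Vec d) : ℝ := ∑ j, jordanTrace (spectralMap ψ (block v j))

/-- The vector `ψ'(v) = (ψ'(v¹), …, ψ'(v^N))`. -/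
def gradVec (ψ : ℝ → ℝ) (v : Vec d) : Vec d :=
  fun p => spectralMap (deriv ψ) (block v p.1) p.2

/-- The proximity measure `δ(v) = ‖ψ'(v)‖ / √2`, with the Euclidean norm. -/
def proximity (ψ : ℝ → ℝ) (v : Vec d) : ℝ := (1 / √2) * √(∑ p, gradVec ψ v p ^ 2)

abbrev Scaling (d : Fin N → ℕ) :=
  (j : Fin N) → Matrix (Fin (d j + 2)) (Fin (d j + 2)) ℝ

/-- `W = diag(W¹, …, W^N)` is a Nesterov-Todd scaling of `(x, s)`: every `W^j` is a symmetric
positive definite automorphism of the `j`-th cone and `W^j x^j = (W^j)⁻¹ s^j`. -/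
def IsNTScaling (W : Scaling d) (x s : Vec d) : Prop :=
  ∀ j, (W j).PosDef ∧ (fun u => W j *ᵥ u) '' cone (d j) = cone (d j) ∧
    W j *ᵥ block x j = (W j)⁻¹ *ᵥ block s j

def ntScaling (x s : Vec d) : Scaling d := Classical.epsilon fun W => IsNTScaling W x s

/-- The matrix of the Nesterov-Todd scaling on the whole space. -/
def ntMatrix (x s : Vec d) :
    Matrix (Σ j : Fin N, Fin (d j + 2)) (Σ j : Fin N, Fin (d j + 2)) ℝ :=
  blockDiagonal' (ntScaling x s)

/-- The scaled vector `v = W x / √μ`. -/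
def scaledVec (x s : Vec d) (μ : ℝ) : Vec d := (1 / √μ) • (ntMatrix x s *ᵥ x)

/-- `Φ(x, s, μ) = Ψ(v)`. -/
def centrality (ψ : ℝ → ℝ) (x s : Vec d) (μ : ℝ) : ℝ := barrier ψ (scaledVec x s μ)

end Product

/-! ### Kernel functions -/

/-- An eligible kernel function `ψ : (0, ∞) → ℝ` (values at `t ≤ 0` are irrelevant). -/
structure IsEligibleKernel (ψ : ℝ → ℝ) : Prop where
  differentiable : ∀ t > 0, DifferentiableAt ℝ ψ t
  differentiable_deriv : ∀ t > 0, DifferentiableAt ℝ (deriv ψ) t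
  differentiable_deriv2 : ∀ t > 0, DifferentiableAt ℝ (deriv (deriv ψ)) t
  map_one : ψ 1 = 0
  deriv_one : deriv ψ 1 = 0
  deriv2_pos : ∀ t > 0, 0 < deriv (deriv ψ) t
  tendsto_zero : Filter.Tendsto ψ (nhdsWithin 0 (Set.Ioi 0)) Filter.atTop
  tendsto_atTop : Filter.Tendsto ψ Filter.atTop Filter.atTop
  cond1 : ∀ t, 0 < t → t < 1 → 0 < t * deriv (deriv ψ) t + deriv ψ t
  cond2 : ∀ t, 1 < t → 0 < t * deriv (deriv ψ) t - deriv ψ t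
  cond3 : ∀ t, 0 < t → deriv (deriv (deriv ψ)) t < 0
  cond4 : ∀ t, 0 < t → t < 1 →
    0 < 2 * deriv (deriv ψ) t ^ 2 - deriv ψ t * deriv (deriv (deriv ψ)) t
  cond5 : ∀ t β, 1 < t → 1 < β →
    0 < deriv (deriv ψ) t * deriv ψ (β * t) - β * deriv ψ t * deriv (deriv ψ) (β * t)

/-- `ϱ`, the inverse function of `ψ` on `[1, ∞)`. -/
def upperInv (ψ : ℝ → ℝ) (r : ℝ) : ℝ := Function.invFunOn ψ (Set.Ici 1) r

/-- `ρ`, the inverse function of `-ψ'/2` on `(0, 1]`. -/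
def lowerInv (ψ : ℝ → ℝ) (r : ℝ) : ℝ :=
  Function.invFunOn (fun t => -(1 / 2) * deriv ψ t) (Set.Ioc 0 1) r

/-- The lower bound `ψ'(ϱ(2r))² / (8 ψ''(ρ(ψ'(ϱ(2r)))))` on the decrease of the barrier
function in one inner iteration, as a function of `r = Ψ(v)`. -/
def decreaseBound (ψ : ℝ → ℝ) (r : ℝ) : ℝ :=
  deriv ψ (upperInv ψ (2 * r)) ^ 2 /
    (8 * deriv (deriv ψ) (lowerInv ψ (deriv ψ (upperInv ψ (2 * r)))))

/-! ### The algorithm -/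

section Algorithm

variable {N m : ℕ} {d : Fin N → ℕ}

/-- The step size `1 / ψ''(ρ(2√2 δ(v)))`. -/
def stepSize (ψ : ℝ → ℝ) (v : Vec d) : ℝ :=
  1 / deriv (deriv ψ) (lowerInv ψ (2 * √2 * proximity ψ v))

/-- `(x, y, s)` is strictly feasible for `min cᵀx, Ax = b, x ∈ Υ` and its dual
`max bᵀy, Aᵀy + s = c, s ∈ Υ` (the cone is self-dual). -/
def StrictlyFeasible (A : Matrix (Fin m) (Σ j : Fin N, Fin (d j + 2)) ℝ)
    (b : Fin m → ℝ) (c : Vec d) (x : Vec d) (y : Fin m → ℝ) (s : Vec d) : Prop :=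
  A *ᵥ x = b ∧ x ∈ interior (productCone d) ∧
    Aᵀ *ᵥ y + s = c ∧ s ∈ interior (productCone d)

/-- `(dx, dy, ds)` solves the scaled system at `(x, s, μ)`: with `Ā = A W⁻¹ / √μ`,
`Ā dx = 0`, `Āᵀ dy + ds = 0`, `dx + ds = -ψ'(v)`. -/
def IsScaledDirection (A : Matrix (Fin m) (Σ j : Fin N, Fin (d j + 2)) ℝ) (ψ : ℝ → ℝ)
    (x s : Vec d) (μ : ℝ) (dx : Vec d) (dy : Fin m → ℝ) (ds : Vec d) : Prop :=
  ((1 / √μ) • (A * (ntMatrix x s)⁻¹)) *ᵥ dx = 0 ∧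
    ((1 / √μ) • (A * (ntMatrix x s)⁻¹))ᵀ *ᵥ dy + ds = 0 ∧
    dx + ds = -gradVec ψ (scaledVec x s μ)

/-- The memory of the algorithm: whether control is at the test of the inner loop or at the
test of the outer loop, the program variables, and three counters: `outer` counts the updates
of `μ`, `inner` the inner iterations since the last update of `μ`, `total` all inner
iterations. -/
structure State (m : ℕ) (d : Fin N → ℕ) where
  inLoop : Bool
  μ : ℝ
  x : Vec d
  y : Fin m → ℝ
  s : Vec d
  outer : ℕ
  inner : ℕ
  total : ℕ

/-- `x = e`, `s = e`, `μ = 1`. -/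
def initial (d : Fin N → ℕ) (y₀ : Fin m → ℝ) : State m d where
  inLoop := false
  μ := 1
  x := unitVec d
  y := y₀
  s := unitVec d
  outer := 0
  inner := 0
  total := 0

/-- One transition of the primal-dual algorithm

`while 3Nμ ≥ ε { μ ← (1-θ)μ; while Φ(x,s,μ) > τ { (x,y,s) ← (x,y,s) + α(Δx,Δy,Δs) } }`

with `Δx = √μ W⁻¹ dx`, `Δy = dy`, `Δs = √μ W ds`. -/
inductive Step (A : Matrix (Fin m) (Σ j : Fin N, Fin (d j + 2)) ℝ) (ψ : ℝ → ℝ)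
    (τ ε θ : ℝ) : State m d → State m d → Prop
  | update (st : State m d) (hloc : st.inLoop = false) (hμ : ε ≤ 3 * N * st.μ) :
      Step A ψ τ ε θ st
        { st with
          inLoop := true
          μ := (1 - θ) * st.μ
          outer := st.outer + 1
          inner := 0 }
  | move (st : State m d) (hloc : st.inLoop = true) (hΦ : τ < centrality ψ st.x st.s st.μ)
      (dx : Vec d) (dy : Fin m → ℝ) (ds : Vec d)
      (hdir : IsScaledDirection A ψ st.x st.s st.μ dx dy ds) :
      Step A ψ τ ε θ st
        { st with
          x := st.x + stepSize ψ (scaledVec st.x st.s st.μ) •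
            (√st.μ • ((ntMatrix st.x st.s)⁻¹ *ᵥ dx))
          y := st.y + stepSize ψ (scaledVec st.x st.s st.μ) • dy
          s := st.s + stepSize ψ (scaledVec st.x st.s st.μ) •
            (√st.μ • (ntMatrix st.x st.s *ᵥ ds))
          inner := st.inner + 1
          total := st.total + 1 }
  | leave (st : State m d) (hloc : st.inLoop = true)
      (hΦ : centrality ψ st.x st.s st.μ ≤ τ) :
      Step A ψ τ ε θ st { st with inLoop := false }

/-- `st` occurs in the run of the algorithm started at `(e, y₀, e)`. -/
def Reachable (A : Matrix (Fin m) (Σ j : Fin N, Fin (d j + 2)) ℝ) (ψ : ℝ → ℝ)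
    (τ ε θ : ℝ) (y₀ : Fin m → ℝ) (st : State m d) : Prop :=
  Relation.ReflTransGen (Step A ψ τ ε θ) (initial d y₀) st

/-- The algorithm returns in the state `st`. -/
def Returns (ε : ℝ) (st : State m d) : Prop := st.inLoop = false ∧ 3 * N * st.μ < ε

/-- Accuracy of a primal-dual triple: it is strictly feasible, and it is `τ`-close to the
`μ`-center, as measured by `Φ`, for a parameter `μ > 0` with `3Nμ < ε`. -/
def IsAccurate (A : Matrix (Fin m) (Σ j : Fin N, Fin (d j + 2)) ℝ) (b : Fin m → ℝ) (c : Vec d)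
    (ψ : ℝ → ℝ) (τ ε μ : ℝ) (x : Vec d) (y : Fin m → ℝ) (s : Vec d) : Prop :=
  StrictlyFeasible A b c x y s ∧ 0 < μ ∧ 3 * N * μ < ε ∧ centrality ψ x s μ ≤ τ

end Algorithm

end TypeTwoSOCO

end

open TypeTwoSOCO

namespace TypeTwoSOCO

open Set Filter Topology

/-! ### Scalar inequalities for eligible kernels. -/

namespace IsEligibleKernel

variable {ψ : ℝ → ℝ}

/-! In the coordinates `x 0 - x 1` and (`x 0 + x 1`, tail) a block is a half-line times a Lorentz
cone, and the Euclidean inner product is half the sum of the two natural ones (`dotProduct_eq`).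
Inequalities for the barrier thereby reduce to inequalities for the kernel at the eigenvalues
`lam1`, `lam2`, `lam4`, which enter the trace with weights 1, 1/2, 1/2.

Scaling. Quadratic representations of the Lorentz part (`boost`) have square roots and act
transitively on vectors of determinant 1, so a Nesterov–Todd scaling exists. A positive definite
cone automorphism with an interior fixed point is the identity, so the scaling is unique; it is
therefore a boost and multiplies `lam1` and `lorDet` by constants
(`IsBlockScaling.exists_similarity`).

Inner iteration. Let D be the norm of ψ'(v) and M = ψ''(ρ(2D)). The directions are orthogonal with
sum -ψ'(v), so each has norm at most D, and the step 1/M keeps all eigenvalues of `v + α dx` and `v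
+ α ds` above ρ(2D). A second order bound with curvature M shows that the mean of the two barrier
values drops by at least D²/(2M) (`barrier_mean_le`); since ψ'(ϱ(2Ψ)) ≤ 2D, this is at least
`decreaseBound`. The new scaled vector is a kind of geometric mean of these two vectors, and
convexity of z ↦ ψ(exp z) bounds its barrier by that mean (`jordanTrace_le_mean`,
`centrality_le_mean`).

Update of μ. The vector v is multiplied by β = 1/√(1-θ). A tangent bound for r ↦ ψ(βϱ(r)), summed
over all eigenvalues, gives the bound L (`map_mul_le`, `barrier_smul_le`).

Counting. By the growth condition and Bernoulli's inequality each inner iteration lowers Φ^γ by at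
least κγ, while an update leaves it at most L^γ. `RunInvariant` carries this budget along the run;
the logarithm of μ bounds the number of updates. -/

theorem hasDerivAt (h : IsEligibleKernel ψ) {t : ℝ} (ht : 0 < t) : HasDerivAt ψ (deriv ψ t) t :=
  (h.differentiable t ht).hasDerivAt

theorem hasDerivAt_deriv (h : IsEligibleKernel ψ) {t : ℝ} (ht : 0 < t) :
    HasDerivAt (deriv ψ) (deriv (deriv ψ) t) t :=
  (h.differentiable_deriv t ht).hasDerivAt

theorem hasDerivAt_deriv2 (h : IsEligibleKernel ψ) {t : ℝ} (ht : 0 < t) :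
    HasDerivAt (deriv (deriv ψ)) (deriv (deriv (deriv ψ)) t) t :=
  (h.differentiable_deriv2 t ht).hasDerivAt

theorem continuousAt (h : IsEligibleKernel ψ) {t : ℝ} (ht : 0 < t) : ContinuousAt ψ t :=
  (h.differentiable t ht).continuousAt

theorem continuousAt_deriv (h : IsEligibleKernel ψ) {t : ℝ} (ht : 0 < t) :
    ContinuousAt (deriv ψ) t :=
  (h.differentiable_deriv t ht).continuousAt

theorem continuousAt_deriv2 (h : IsEligibleKernel ψ) {t : ℝ} (ht : 0 < t) :
    ContinuousAt (deriv (deriv ψ)) t :=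
  (h.differentiable_deriv2 t ht).continuousAt

theorem strictMonoOn_deriv (h : IsEligibleKernel ψ) : StrictMonoOn (deriv ψ) (Ioi 0) :=
  strictMonoOn_of_deriv_pos (convex_Ioi 0)
    (fun _ ht => (h.continuousAt_deriv ht).continuousWithinAt)
    (fun t ht => h.deriv2_pos t (by simpa using ht))

theorem strictAntiOn_deriv2 (h : IsEligibleKernel ψ) : StrictAntiOn (deriv (deriv ψ)) (Ioi 0) :=
  strictAntiOn_of_deriv_neg (convex_Ioi 0)
    (fun _ ht => (h.continuousAt_deriv2 ht).continuousWithinAt)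
    (fun t ht => h.cond3 t (by simpa using ht))

theorem deriv_pos (h : IsEligibleKernel ψ) {t : ℝ} (ht : 1 < t) : 0 < deriv ψ t := by
  have := h.strictMonoOn_deriv (by simp : (1 : ℝ) ∈ Ioi 0) (by simp; linarith : t ∈ Ioi (0 : ℝ)) ht
  rwa [h.deriv_one] at this

theorem deriv_neg (h : IsEligibleKernel ψ) {t : ℝ} (ht0 : 0 < t) (ht : t < 1) :
    deriv ψ t < 0 := by
  have := h.strictMonoOn_deriv (mem_Ioi.2 ht0) (by simp : (1 : ℝ) ∈ Ioi 0) ht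
  rwa [h.deriv_one] at this

theorem deriv_nonneg (h : IsEligibleKernel ψ) {t : ℝ} (ht : 1 ≤ t) : 0 ≤ deriv ψ t := by
  rcases ht.eq_or_lt with rfl | ht
  · exact h.deriv_one.ge
  · exact (h.deriv_pos ht).le

theorem strictMonoOn (h : IsEligibleKernel ψ) : StrictMonoOn ψ (Ici 1) :=
  strictMonoOn_of_deriv_pos (convex_Ici 1)
    (fun t ht => (h.continuousAt (zero_lt_one.trans_le ht)).continuousWithinAt)
    (fun t ht => h.deriv_pos (by simpa using ht))

theorem strictAntiOn (h : IsEligibleKernel ψ) : StrictAntiOn ψ (Ioc 0 1) :=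
  strictAntiOn_of_deriv_neg (convex_Ioc 0 1)
    (fun t ht => (h.continuousAt ht.1).continuousWithinAt)
    (fun t ht => by
      rw [interior_Ioc] at ht
      exact h.deriv_neg ht.1 ht.2)

theorem nonneg (h : IsEligibleKernel ψ) {t : ℝ} (ht : 0 < t) : 0 ≤ ψ t := by
  rw [← h.map_one]
  rcases le_total t 1 with h1 | h1
  · exact h.strictAntiOn.antitoneOn ⟨ht, h1⟩ ⟨zero_lt_one, le_rfl⟩ h1
  · exact h.strictMonoOn.monotoneOn self_mem_Ici h1 h1

theorem mem_image_Ici (h : IsEligibleKernel ψ) {r : ℝ} (hr : 0 ≤ r) :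
    ∃ t ∈ Ici (1 : ℝ), ψ t = r := by
  obtain ⟨b, hb1, hb⟩ :=
    ((h.tendsto_atTop.eventually_ge_atTop r).and (eventually_ge_atTop (1 : ℝ))).exists
  have := intermediate_value_Icc hb
    (fun t ht => (h.continuousAt (zero_lt_one.trans_le ht.1)).continuousWithinAt)
  obtain ⟨t, ht, rfl⟩ := this (⟨by rwa [h.map_one], hb1⟩ : r ∈ Icc (ψ 1) (ψ b))
  exact ⟨t, ht.1, rfl⟩

theorem one_le_upperInv (h : IsEligibleKernel ψ) {r : ℝ} (hr : 0 ≤ r) : 1 ≤ upperInv ψ r :=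
  Function.invFunOn_mem (h.mem_image_Ici hr)

theorem map_upperInv (h : IsEligibleKernel ψ) {r : ℝ} (hr : 0 ≤ r) : ψ (upperInv ψ r) = r :=
  Function.invFunOn_eq (h.mem_image_Ici hr)

theorem one_lt_upperInv (h : IsEligibleKernel ψ) {r : ℝ} (hr : 0 < r) : 1 < upperInv ψ r := by
  refine (h.one_le_upperInv hr.le).lt_of_ne fun he => hr.ne ?_
  have := h.map_upperInv hr.le
  rwa [← he, h.map_one] at this

/-- If ψ' stayed above -2r on (0, 1], the mean value theorem would bound ψ there, against its
blow-up at 0. The intermediate value theorem does the rest. -/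
theorem mem_image_Ioc (h : IsEligibleKernel ψ) {r : ℝ} (hr : 0 ≤ r) :
    ∃ t ∈ Ioc (0 : ℝ) 1, -(1 / 2) * deriv ψ t = r := by
  have key : ∃ a ∈ Ioc (0 : ℝ) 1, deriv ψ a ≤ -(2 * r) := by
    by_contra! hcon
    obtain ⟨a, ha, ha0, ha1⟩ := ((h.tendsto_zero.eventually_ge_atTop (2 * r + 1)).and
      (Ioo_mem_nhdsGT (zero_lt_one (α := ℝ)))).exists
    obtain ⟨c, hc, hc'⟩ := exists_deriv_eq_slope ψ ha1
      (fun t ht => (h.continuousAt (ha0.trans_le ht.1)).continuousWithinAt)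
      (fun t ht => (h.differentiable t (ha0.trans ht.1)).differentiableWithinAt)
    have h1 := hcon c ⟨ha0.trans hc.1, hc.2.le⟩
    rw [hc', h.map_one, lt_div_iff₀ (by linarith)] at h1
    nlinarith
  obtain ⟨a, ha, har⟩ := key
  have := intermediate_value_Icc' ha.2 (f := fun t => -(1 / 2) * deriv ψ t)
    (fun t ht => (continuousAt_const.mul
      (h.continuousAt_deriv (ha.1.trans_le ht.1))).continuousWithinAt)
  obtain ⟨t, ht, hte⟩ := this (⟨by simpa [h.deriv_one] using hr, by linarith⟩ :
    r ∈ Icc (-(1 / 2) * deriv ψ 1) (-(1 / 2) * deriv ψ a))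
  exact ⟨t, ⟨ha.1.trans_le ht.1, ht.2⟩, hte⟩

theorem lowerInv_mem (h : IsEligibleKernel ψ) {r : ℝ} (hr : 0 ≤ r) :
    lowerInv ψ r ∈ Ioc (0 : ℝ) 1 :=
  Function.invFunOn_mem (f := fun t => -(1 / 2) * deriv ψ t) (h.mem_image_Ioc hr)

theorem deriv_lowerInv (h : IsEligibleKernel ψ) {r : ℝ} (hr : 0 ≤ r) :
    deriv ψ (lowerInv ψ r) = -(2 * r) := by
  have := Function.invFunOn_eq (f := fun t => -(1 / 2) * deriv ψ t) (h.mem_image_Ioc hr)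
  simp only [← lowerInv.eq_def] at this
  linarith

theorem lowerInv_le (h : IsEligibleKernel ψ) {r t : ℝ} (hr : 0 ≤ r) (ht : 0 < t)
    (hrt : -(2 * r) ≤ deriv ψ t) : lowerInv ψ r ≤ t := by
  rw [← h.deriv_lowerInv hr] at hrt
  exact (h.strictMonoOn_deriv.le_iff_le (h.lowerInv_mem hr).1 ht).1 hrt

theorem lowerInv_anti (h : IsEligibleKernel ψ) {r s : ℝ} (hr : 0 ≤ r) (hrs : r ≤ s) :
    lowerInv ψ s ≤ lowerInv ψ r :=
  h.lowerInv_le (hr.trans hrs) (h.lowerInv_mem hr).1 (by rw [h.deriv_lowerInv hr]; linarith)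

/-- The step `1 / ψ''(ρ(2D))` keeps the smallest eigenvalue above `ρ(2D)`. -/
theorem lowerInv_two_mul_add_le (h : IsEligibleKernel ψ) {D : ℝ} (hD : 0 ≤ D) :
    lowerInv ψ (2 * D) + 2 * (1 / deriv (deriv ψ) (lowerInv ψ (2 * D))) * D ≤ lowerInv ψ D := by
  have h2 : 0 ≤ 2 * D := by linarith
  set a := lowerInv ψ (2 * D)
  set b := lowerInv ψ D
  have ha : 0 < a := (h.lowerInv_mem h2).1
  have hM := h.deriv2_pos a ha
  have hab : a ≤ b := h.lowerInv_anti hD (by linarith)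
  have ha' := h.deriv_lowerInv h2
  have hb' := h.deriv_lowerInv hD
  rcases hab.eq_or_lt with heq | hlt
  · have : D = 0 := by
      change deriv ψ a = _ at ha'
      change deriv ψ b = _ at hb'
      rw [heq] at ha'; linarith
    rw [this]; linarith
  -- Between a and b the derivative ψ' rises from -4D to -2D with slope at most ψ''(a), since ψ''
  -- decreases; so b - a is at least 2D/ψ''(a).
  · obtain ⟨c, hc, hc'⟩ := exists_deriv_eq_slope (deriv ψ) hlt
      (fun t ht => (h.continuousAt_deriv (ha.trans_le ht.1)).continuousWithinAt)
      (fun t ht => (h.differentiable_deriv t (ha.trans ht.1)).differentiableWithinAt)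
    have hca : deriv (deriv ψ) c ≤ deriv (deriv ψ) a :=
      h.strictAntiOn_deriv2.antitoneOn ha (ha.trans hc.1) hc.1.le
    rw [hc', div_le_iff₀ (by linarith), ha', hb'] at hca
    have : 2 * (1 / deriv (deriv ψ) a) * D ≤ b - a := by
      rw [show 2 * (1 / deriv (deriv ψ) a) * D = 2 * D / deriv (deriv ψ) a by ring,
        div_le_iff₀ hM]
      linarith
    linarith

/-- Second order upper bound with the curvature at the left end. -/
theorem le_taylor (h : IsEligibleKernel ψ) {l s t : ℝ} (hl : 0 < l) (hs : l ≤ s) (ht : l ≤ t) :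
    ψ s ≤ ψ t + deriv ψ t * (s - t) + deriv (deriv ψ) l / 2 * (s - t) ^ 2 := by
  set M := deriv (deriv ψ) l
  have hd : ∀ u, 0 < u → HasDerivAt (fun u => M / 2 * u ^ 2 - ψ u) (M * u - deriv ψ u) u := by
    intro u hu
    have := ((hasDerivAt_pow 2 u).const_mul (M / 2)).sub (h.hasDerivAt hu)
    exact this.congr_deriv (by simp; ring)
  have hd2 : ∀ u, 0 < u →
      HasDerivAt (fun u => M * u - deriv ψ u) (M - deriv (deriv ψ) u) u := by
    intro u hu
    have := ((hasDerivAt_id u).const_mul M).sub (h.hasDerivAt_deriv hu)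
    exact this.congr_deriv (by simp)
  -- As ψ'' decreases, ψ'' ≤ M on [l, ∞), so M u²/2 - ψ(u) is convex there; the claim is its tangent
  -- inequality at t.
  have hmono : MonotoneOn (fun u => M * u - deriv ψ u) (Ici l) := by
    apply monotoneOn_of_deriv_nonneg (convex_Ici l)
      (fun u hu => (hd2 u (hl.trans_le hu)).continuousAt.continuousWithinAt)
    · intro u hu
      rw [interior_Ici] at hu
      exact (hd2 u (hl.trans hu)).differentiableAt.differentiableWithinAt
    · intro u hu
      rw [interior_Ici] at hu
      rw [(hd2 u (hl.trans hu)).deriv, sub_nonneg]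
      exact h.strictAntiOn_deriv2.antitoneOn hl (hl.trans hu) (le_of_lt hu)
  have hconv : ConvexOn ℝ (Ici l) (fun u => M / 2 * u ^ 2 - ψ u) := by
    apply MonotoneOn.convexOn_of_deriv (convex_Ici l)
      (fun u hu => (hd u (hl.trans_le hu)).continuousAt.continuousWithinAt)
    · intro u hu
      rw [interior_Ici] at hu
      exact (hd u (hl.trans hu)).differentiableAt.differentiableWithinAt
    · rw [interior_Ici]
      intro u hu w hw huw
      rw [(hd u (hl.trans hu)).deriv, (hd w (hl.trans hw)).deriv]
      exact hmono (mem_Ici_of_Ioi hu) (mem_Ici_of_Ioi hw) huw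
  have hdt := hd t (hl.trans_le ht)
  rcases lt_trichotomy s t with hst | rfl | hst
  · have := hconv.slope_le_of_hasDerivAt hs ht hst hdt
    rw [slope_def_field, div_le_iff₀ (by linarith)] at this
    nlinarith
  · simp
  · have := hconv.le_slope_of_hasDerivAt ht hs hst hdt
    rw [slope_def_field, le_div_iff₀ (by linarith)] at this
    nlinarith

/-- A kernel function is convex in the logarithm of its argument. -/
theorem convexOn_comp_exp (h : IsEligibleKernel ψ) :
    ConvexOn ℝ univ (fun z => ψ (Real.exp z)) := by
  have hd : ∀ z, HasDerivAt (fun z => ψ (Real.exp z)) (Real.exp z * deriv ψ (Real.exp z)) z := by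
    intro z
    have := (h.hasDerivAt (Real.exp_pos z)).comp z (Real.hasDerivAt_exp z)
    simpa [mul_comm, Function.comp_def] using this
  have hd2 : ∀ t, 0 < t →
      HasDerivAt (fun t => t * deriv ψ t) (deriv ψ t + t * deriv (deriv ψ) t) t := by
    intro t ht
    exact ((hasDerivAt_id t).mul (h.hasDerivAt_deriv ht)).congr_deriv (by simp)
  have hmono : MonotoneOn (fun t => t * deriv ψ t) (Ioi 0) := by
    apply monotoneOn_of_deriv_nonneg (convex_Ioi 0)
      (fun u hu => (hd2 u hu).continuousAt.continuousWithinAt)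
    · rw [interior_Ioi]
      exact fun u hu => (hd2 u hu).differentiableAt.differentiableWithinAt
    · rw [interior_Ioi]
      intro u hu
      rw [(hd2 u hu).deriv]
      have hu : 0 < u := hu
      -- The derivative of tψ'(t) is positive by `cond1` below 1; from 1 on both of its terms are
      -- nonnegative.
      rcases lt_or_ge u 1 with h1 | h1
      · linarith [h.cond1 u hu h1]
      · have := h.deriv_nonneg h1
        have := mul_pos hu (h.deriv2_pos u hu)
        linarith
  apply MonotoneOn.convexOn_of_deriv convex_univ
    (fun u _ => (hd u).continuousAt.continuousWithinAt)
    (fun u _ => (hd u).differentiableAt.differentiableWithinAt)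
  intro u _ w _ huw
  rw [(hd u).deriv, (hd w).deriv]
  exact hmono (Real.exp_pos u) (Real.exp_pos w) (Real.exp_le_exp.2 huw)

/-- Midpoint case of convexity in the logarithm. -/
theorem map_le_of_sq_eq (h : IsEligibleKernel ψ) {a b v : ℝ} (ha : 0 < a) (hb : 0 < b)
    (hv : 0 < v) (hvab : v ^ 2 = a * b) : ψ v ≤ (ψ a + ψ b) / 2 := by
  have := h.convexOn_comp_exp.2 (mem_univ (Real.log a)) (mem_univ (Real.log b))
    (by norm_num : (0 : ℝ) ≤ 1 / 2) (by norm_num : (0 : ℝ) ≤ 1 / 2) (by norm_num)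
  have hlog : Real.log v = 1 / 2 * Real.log a + 1 / 2 * Real.log b := by
    have := congrArg Real.log hvab
    rw [Real.log_pow, Real.log_mul ha.ne' hb.ne'] at this
    push_cast at this
    linarith
  simp only [smul_eq_mul, ← hlog, Real.exp_log ha, Real.exp_log hb, Real.exp_log hv] at this
  linarith

/-- Spreading two positive numbers while keeping their product increases the sum. -/
theorem add_le_add_of_mul_eq (h : IsEligibleKernel ψ) {v w a b : ℝ} (ha : 0 < a) (hav : a ≤ v)
    (hvb : v ≤ b) (hw : 0 < w) (hmul : v * w = a * b) : ψ v + ψ w ≤ ψ a + ψ b := by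
  have hv : 0 < v := ha.trans_le hav
  have hb : 0 < b := hv.trans_le hvb
  have hl : Real.log v + Real.log w = Real.log a + Real.log b := by
    rw [← Real.log_mul hv.ne' hw.ne', ← Real.log_mul ha.ne' hb.ne', hmul]
  have h1 := Real.log_le_log ha hav
  have h2 := Real.log_le_log hv hvb
  rcases (h1.trans h2).eq_or_lt with heq | hlt
  · have e1 : v = a := by
      rw [← Real.exp_log hv, ← Real.exp_log ha]; congr 1; linarith
    have e2 : w = b := by
      rw [← Real.exp_log hw, ← Real.exp_log hb]; congr 1; linarith
    rw [e1, e2]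
  -- The logarithms of v and w have sum p + q, so they are convex combinations of p and q with
  -- swapped weights; the two convexity inequalities add up to the claim.
  · set p := Real.log a
    set q := Real.log b
    set c := (q - Real.log v) / (q - p)
    have hqp : 0 < q - p := by linarith
    have hc0 : 0 ≤ c := div_nonneg (by linarith) hqp.le
    have hc1 : 0 ≤ 1 - c := by
      rw [sub_nonneg, div_le_one hqp]; linarith
    have hc : c * (q - p) = q - Real.log v := div_mul_cancel₀ _ hqp.ne'
    have e1 : Real.log v = c * p + (1 - c) * q := by linarith
    have e2 : Real.log w = (1 - c) * p + c * q := by linarith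
    have k1 := h.convexOn_comp_exp.2 (mem_univ p) (mem_univ q) hc0 hc1 (by ring)
    have k2 := h.convexOn_comp_exp.2 (mem_univ p) (mem_univ q) hc1 hc0 (by ring)
    simp only [smul_eq_mul, ← e1, ← e2, Real.exp_log hv, Real.exp_log hw] at k1 k2
    rw [Real.exp_log ha, Real.exp_log hb] at k1 k2
    nlinarith

/-- Cauchy's mean value theorem for ψ'² against ψ, with the common factor ψ'(c) cancelled. Callers
know that c lies on one side of 1, where ψ' does not vanish. -/
theorem exists_sq_deriv_sub (h : IsEligibleKernel ψ) {a b : ℝ} (ha : 0 < a) (hab : a < b) :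
    ∃ c ∈ Ioo a b, deriv ψ c ≠ 0 →
      deriv ψ b ^ 2 - deriv ψ a ^ 2 = 2 * deriv (deriv ψ) c * (ψ b - ψ a) := by
  obtain ⟨c, hc, hc'⟩ := exists_ratio_hasDerivAt_eq_ratio_slope (fun t => deriv ψ t ^ 2)
    (fun t => 2 * deriv ψ t * deriv (deriv ψ) t) hab
    (fun t ht => ((h.continuousAt_deriv (ha.trans_le ht.1)).pow 2).continuousWithinAt)
    (fun t ht => by
      exact ((h.hasDerivAt_deriv (ha.trans ht.1)).pow 2).congr_deriv (by simp))
    ψ (deriv ψ) (fun t ht => (h.continuousAt (ha.trans_le ht.1)).continuousWithinAt)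
    (fun t ht => h.hasDerivAt (ha.trans ht.1))
  refine ⟨c, hc, fun h0 => mul_right_cancel₀ h0 ?_⟩
  linarith

/-- `ψ'² / ψ` is smallest at the right end. -/
theorem sq_deriv_mul_le (h : IsEligibleKernel ψ) {z t : ℝ} (hz : 1 < z) (ht : 0 < t)
    (htz : ψ t ≤ ψ z) : deriv ψ z ^ 2 * ψ t ≤ deriv ψ t ^ 2 * ψ z := by
  have hz0 := h.nonneg (zero_lt_one.trans hz)
  have ht0 := h.nonneg ht
  have hanti := h.strictAntiOn_deriv2.antitoneOn
  rcases lt_trichotomy t 1 with ht1 | rfl | ht1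
  · obtain ⟨c, hc, hc'⟩ := h.exists_sq_deriv_sub ht ht1
    obtain ⟨e, he, he'⟩ := h.exists_sq_deriv_sub one_pos hz
    have hc0 : 0 < c := ht.trans hc.1
    have he0 : 0 < e := one_pos.trans he.1
    specialize hc' (h.deriv_neg hc0 hc.2).ne
    specialize he' (h.deriv_pos he.1).ne'
    rw [h.deriv_one, h.map_one] at hc' he'
    have hce : deriv (deriv ψ) e ≤ deriv (deriv ψ) c := hanti hc0 he0 (hc.2.trans he.1).le
    have e1 : deriv ψ t ^ 2 = 2 * deriv (deriv ψ) c * ψ t := by linarith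
    have e2 : deriv ψ z ^ 2 = 2 * deriv (deriv ψ) e * ψ z := by linarith
    rw [e1, e2]
    nlinarith [mul_nonneg ht0 hz0]
  · rw [h.map_one]
    have := mul_nonneg (sq_nonneg (deriv ψ 1)) hz0
    linarith
  · have htz' : t ≤ z := (h.strictMonoOn.le_iff_le ht1.le hz.le).1 htz
    rcases htz'.eq_or_lt with rfl | hlt
    · exact le_rfl
    obtain ⟨c, hc, hc'⟩ := h.exists_sq_deriv_sub one_pos ht1
    obtain ⟨e, he, he'⟩ := h.exists_sq_deriv_sub ht hlt
    have hc0 : 0 < c := one_pos.trans hc.1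
    have he0 : 0 < e := ht.trans he.1
    specialize hc' (h.deriv_pos hc.1).ne'
    specialize he' (h.deriv_pos (ht1.trans he.1)).ne'
    rw [h.deriv_one, h.map_one] at hc'
    have hce : deriv (deriv ψ) e ≤ deriv (deriv ψ) c := hanti hc0 he0 (hc.2.trans he.1).le
    have e1 : deriv ψ t ^ 2 = 2 * deriv (deriv ψ) c * ψ t := by linarith
    have e2 : deriv ψ z ^ 2 = 2 * deriv (deriv ψ) c * ψ t
        + 2 * deriv (deriv ψ) e * (ψ z - ψ t) := by linarith
    rw [e1, e2]
    nlinarith [mul_nonneg ht0 (sub_nonneg.2 htz)]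

/-- Tangent bound for `r ↦ ψ(β ϱ(r))` at `r = ψ z`. -/
theorem map_mul_le (h : IsEligibleKernel ψ) {z β t : ℝ} (hz : 1 < z) (hβ : 1 < β) (ht : 0 < t) :
    ψ (β * t) ≤ ψ (β * z) + β * deriv ψ (β * z) / deriv ψ z * (ψ t - ψ z) := by
  have hβ0 : 0 < β := by linarith
  set K := β * deriv ψ (β * z) / deriv ψ z
  have hpz := h.deriv_pos hz
  have hd : ∀ u, 0 < u →
      HasDerivAt (fun u => ψ (β * u) - K * ψ u) (β * deriv ψ (β * u) - K * deriv ψ u) u := by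
    intro u hu
    have h1 := (h.hasDerivAt (mul_pos hβ0 hu)).comp u ((hasDerivAt_id u).const_mul β)
    have := h1.sub ((h.hasDerivAt hu).const_mul K)
    exact this.congr_deriv (by simp [mul_comm])
  have hr : ∀ u, 0 < u → deriv ψ u ≠ 0 → HasDerivAt (fun u => β * deriv ψ (β * u) / deriv ψ u)
      ((β * (deriv (deriv ψ) (β * u) * β) * deriv ψ u - β * deriv ψ (β * u) * deriv (deriv ψ) u)
        / deriv ψ u ^ 2) u := by
    intro u hu hu'
    have h1 := ((h.hasDerivAt_deriv (mul_pos hβ0 hu)).comp u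
      ((hasDerivAt_id u).const_mul β)).const_mul β
    have := h1.div (h.hasDerivAt_deriv hu) hu'
    exact this.congr_deriv (by simp)
  -- This ratio is the slope of r ↦ ψ(βϱ(r)) at r = ψ(u), and `cond5` is the sign of its derivative.
  -- Hence ψ(βu) - Kψ(u) is largest at u = z.
  have hanti : AntitoneOn (fun u => β * deriv ψ (β * u) / deriv ψ u) (Ioi 1) := by
    apply antitoneOn_of_deriv_nonpos (convex_Ioi 1)
    · intro u hu
      exact (hr u (one_pos.trans hu) (h.deriv_pos hu).ne').continuousAt.continuousWithinAt
    · rw [interior_Ioi]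
      intro u hu
      exact (hr u (one_pos.trans hu)
        (h.deriv_pos hu).ne').differentiableAt.differentiableWithinAt
    · rw [interior_Ioi]
      intro u hu
      rw [(hr u (one_pos.trans hu) (h.deriv_pos hu).ne').deriv]
      apply div_nonpos_of_nonpos_of_nonneg _ (sq_nonneg _)
      have := mul_pos hβ0 (h.cond5 u β hu hβ)
      nlinarith
  have main : ∀ u, 1 ≤ u → ψ (β * u) - K * ψ u ≤ ψ (β * z) - K * ψ z := by
    intro u hu
    rcases le_total u z with huz | huz
    · have : MonotoneOn (fun u => ψ (β * u) - K * ψ u) (Icc 1 z) := by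
        apply monotoneOn_of_deriv_nonneg (convex_Icc 1 z)
        · exact fun w hw => (hd w (one_pos.trans_le hw.1)).continuousAt.continuousWithinAt
        · rw [interior_Icc]
          exact fun w hw => (hd w (one_pos.trans hw.1)).differentiableAt.differentiableWithinAt
        · rw [interior_Icc]
          intro w hw
          rw [(hd w (one_pos.trans hw.1)).deriv]
          have h1 : K ≤ β * deriv ψ (β * w) / deriv ψ w := hanti hw.1 hz hw.2.le
          rw [le_div_iff₀ (h.deriv_pos hw.1)] at h1
          linarith
      exact this ⟨hu, huz⟩ ⟨hz.le, le_rfl⟩ huz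
    · have : AntitoneOn (fun u => ψ (β * u) - K * ψ u) (Ici z) := by
        apply antitoneOn_of_deriv_nonpos (convex_Ici z)
        · exact fun w hw =>
            (hd w (one_pos.trans (hz.trans_le hw))).continuousAt.continuousWithinAt
        · rw [interior_Ici]
          exact fun w hw =>
            (hd w (one_pos.trans (hz.trans hw))).differentiableAt.differentiableWithinAt
        · rw [interior_Ici]
          intro w hw
          have hw1 : 1 < w := hz.trans hw
          rw [(hd w (one_pos.trans hw1)).deriv]
          have h1 : β * deriv ψ (β * w) / deriv ψ w ≤ K := hanti hz hw1 (le_of_lt hw)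
          rw [div_le_iff₀ (h.deriv_pos hw1)] at h1
          linarith
      exact this self_mem_Ici huz huz
  rcases le_or_gt 1 t with h1 | h1
  · linarith [main t h1]
  -- For t < 1 pass to the point t' ≥ 1 with the same kernel value. This can only increase ψ(βt),
  -- whether βt is still below 1 or has crossed it.
  · have ht0 := h.nonneg ht
    set t' := upperInv ψ (ψ t)
    have ht' : 1 ≤ t' := h.one_le_upperInv ht0
    have hψ : ψ t' = ψ t := h.map_upperInv ht0
    have hβt' : t' ≤ β * t' := by nlinarith
    have hle : ψ (β * t) ≤ ψ (β * t') := by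
      rcases le_or_gt 1 (β * t) with h2 | h2
      · exact h.strictMonoOn.monotoneOn h2 (ht'.trans hβt')
          (mul_le_mul_of_nonneg_left (h1.le.trans ht') hβ0.le)
      · calc ψ (β * t) ≤ ψ t := h.strictAntiOn.antitoneOn ⟨ht, h1.le⟩
              ⟨mul_pos hβ0 ht, h2.le⟩ (by nlinarith)
          _ = ψ t' := hψ.symm
          _ ≤ _ := h.strictMonoOn.monotoneOn ht' (ht'.trans hβt') hβt'
    have := main t' ht'
    rw [hψ] at this
    linarith

/-- The derivative is ψ'(2ψ''² - ψ'ψ''')/ψ''², and `cond4` makes the bracket positive where ψ' < 0.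
-/
theorem antitoneOn_sq_deriv_div (h : IsEligibleKernel ψ) :
    AntitoneOn (fun t => deriv ψ t ^ 2 / deriv (deriv ψ) t) (Ioc 0 1) := by
  have hd : ∀ t, 0 < t → HasDerivAt (fun t => deriv ψ t ^ 2 / deriv (deriv ψ) t)
      ((2 * deriv ψ t * deriv (deriv ψ) t * deriv (deriv ψ) t
        - deriv ψ t ^ 2 * deriv (deriv (deriv ψ)) t) / deriv (deriv ψ) t ^ 2) t := by
    intro t ht
    have := ((h.hasDerivAt_deriv ht).pow 2).div (h.hasDerivAt_deriv2 ht) (h.deriv2_pos t ht).ne'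
    exact this.congr_deriv (by simp)
  apply antitoneOn_of_deriv_nonpos (convex_Ioc 0 1)
  · exact fun t ht => (hd t ht.1).continuousAt.continuousWithinAt
  · rw [interior_Ioc]
    exact fun t ht => (hd t ht.1).differentiableAt.differentiableWithinAt
  · rw [interior_Ioc]
    intro t ht
    rw [(hd t ht.1).deriv]
    apply div_nonpos_of_nonpos_of_nonneg _ (sq_nonneg _)
    have h1 := h.deriv_neg ht.1 ht.2
    have h2 := h.cond4 t ht.1 ht.2
    nlinarith

/-- Since ψ'(ρ(q)) = -2q, this function is ψ'²/ψ'' composed with ρ up to a constant, and both are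
antitone. It permits replacing the norm of the gradient by its lower bound in terms of Ψ. -/
theorem sq_div_mono (h : IsEligibleKernel ψ) {q r : ℝ} (hq : 0 ≤ q) (hqr : q ≤ r) :
    q ^ 2 / (8 * deriv (deriv ψ) (lowerInv ψ q)) ≤
      r ^ 2 / (8 * deriv (deriv ψ) (lowerInv ψ r)) := by
  have hr : 0 ≤ r := hq.trans hqr
  have := h.antitoneOn_sq_deriv_div (h.lowerInv_mem hr) (h.lowerInv_mem hq)
    (h.lowerInv_anti hq hqr)
  simp only [h.deriv_lowerInv hr, h.deriv_lowerInv hq] at this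
  calc q ^ 2 / (8 * deriv (deriv ψ) (lowerInv ψ q))
      = 1 / 32 * ((-(2 * q)) ^ 2 / deriv (deriv ψ) (lowerInv ψ q)) := by
        have := (h.deriv2_pos _ (h.lowerInv_mem hq).1).ne'
        field_simp; ring
    _ ≤ 1 / 32 * ((-(2 * r)) ^ 2 / deriv (deriv ψ) (lowerInv ψ r)) := by linarith
    _ = _ := by
        have := (h.deriv2_pos _ (h.lowerInv_mem hr).1).ne'
        field_simp; ring

end IsEligibleKernel

/-! ### Spectral geometry of a single block. -/

section Block

variable {d : ℕ}

/-- The inner product `(x₁ + x₂)(s₁ + s₂) + 2 ∑_{i ≥ 3} xᵢ sᵢ` of the Lorentz parts. -/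
def lorInner (x s : Block d) : ℝ :=
  (x 0 + x 1) * (s 0 + s 1) + 2 * ∑ i : Fin d, x i.succ.succ * s i.succ.succ

/-- The determinant `(x₁ + x₂)² - 2 ∑_{i ≥ 3} xᵢ²` of the Lorentz part. -/
def lorDet (x : Block d) : ℝ := (x 0 + x 1) ^ 2 - 2 * ∑ i : Fin d, x i.succ.succ ^ 2

theorem tailNorm_nonneg (x : Block d) : 0 ≤ tailNorm x := Real.sqrt_nonneg _

theorem tailNorm_sq (x : Block d) : tailNorm x ^ 2 = ∑ i : Fin d, x i.succ.succ ^ 2 :=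
  Real.sq_sqrt (Finset.sum_nonneg fun _ _ => sq_nonneg _)

theorem abs_sum_tail_le (x s : Block d) :
    |∑ i : Fin d, x i.succ.succ * s i.succ.succ| ≤ tailNorm x * tailNorm s := by
  apply abs_le_of_sq_le_sq
  · rw [mul_pow, tailNorm_sq, tailNorm_sq]
    exact Finset.sum_mul_sq_le_sq_mul_sq _ _ _
  · exact mul_nonneg (tailNorm_nonneg x) (tailNorm_nonneg s)

theorem tailNorm_add_le (x y : Block d) : tailNorm (x + y) ≤ tailNorm x + tailNorm y := by
  apply le_of_sq_le_sq _ (add_nonneg (tailNorm_nonneg x) (tailNorm_nonneg y))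
  have h : tailNorm (x + y) ^ 2 =
      tailNorm x ^ 2 + tailNorm y ^ 2 + 2 * ∑ i : Fin d, x i.succ.succ * y i.succ.succ := by
    simp only [tailNorm_sq, Finset.mul_sum, ← Finset.sum_add_distrib, Pi.add_apply]
    exact Finset.sum_congr rfl fun i _ => by ring
  have := (abs_le.1 (abs_sum_tail_le x y)).2
  nlinarith

theorem tailNorm_neg (x : Block d) : tailNorm (-x) = tailNorm x := by
  simp [tailNorm]

theorem tailNorm_smul (r : ℝ) (x : Block d) : tailNorm (r • x) = |r| * tailNorm x := by
  rw [tailNorm, tailNorm, ← Real.sqrt_sq_eq_abs, ← Real.sqrt_mul (sq_nonneg r), Finset.mul_sum]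
  simp [mul_pow]

theorem continuous_tailNorm : Continuous (tailNorm : Block d → ℝ) := by
  unfold tailNorm; fun_prop

theorem lam2_le_lam4 (x : Block d) : lam2 x ≤ lam4 x := by
  have := mul_nonneg (Real.sqrt_nonneg 2) (tailNorm_nonneg x)
  unfold lam2 lam4; linarith

theorem sqrt_two_mul_tailNorm_sq (x : Block d) :
    (√2 * tailNorm x) ^ 2 = 2 * ∑ i : Fin d, x i.succ.succ ^ 2 := by
  rw [mul_pow, tailNorm_sq, Real.sq_sqrt zero_le_two]

theorem lam2_mul_lam4 (x : Block d) : lam2 x * lam4 x = lorDet x := by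
  have := sqrt_two_mul_tailNorm_sq x
  unfold lam2 lam4 lorDet; linarith

theorem lorInner_self (x : Block d) : lorInner x x = (lam2 x ^ 2 + lam4 x ^ 2) / 2 := by
  have := sqrt_two_mul_tailNorm_sq x
  have h : ∑ i : Fin d, x i.succ.succ * x i.succ.succ = ∑ i : Fin d, x i.succ.succ ^ 2 :=
    Finset.sum_congr rfl fun i _ => by ring
  unfold lam2 lam4 lorInner; rw [h]; linarith

theorem dotProduct_eq (x s : Block d) : x ⬝ᵥ s = (lam1 x * lam1 s + lorInner x s) / 2 := by
  simp only [dotProduct, Fin.sum_univ_succ, lam1, lorInner]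
  simp only [Fin.succ_zero_eq_one]
  ring

/-- Cauchy–Schwarz on the tails: the inner product is largest when the tails are aligned, that is
when equally ordered eigenvalues are paired. -/
theorem lorInner_le (x s : Block d) :
    lorInner x s ≤ (lam2 x * lam2 s + lam4 x * lam4 s) / 2 := by
  have h := (abs_le.1 (abs_sum_tail_le x s)).2
  have h2 : √2 * √2 = 2 := Real.mul_self_sqrt zero_le_two
  have : (lam2 x * lam2 s + lam4 x * lam4 s) / 2 =
      (x 0 + x 1) * (s 0 + s 1) + √2 * √2 * (tailNorm x * tailNorm s) := by
    unfold lam2 lam4; ring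
  rw [this, h2, lorInner]; linarith

theorem mem_cone_iff (x : Block d) : x ∈ cone d ↔ 0 ≤ lam1 x ∧ 0 ≤ lam2 x := by
  have hs := sqrt_two_mul_tailNorm_sq x
  have hn : 0 ≤ √2 * tailNorm x := mul_nonneg (Real.sqrt_nonneg 2) (tailNorm_nonneg x)
  simp only [cone, mem_ofPred_eq, lam1, lam2, ← hs]
  constructor
  · rintro ⟨h1, h2, h3⟩
    exact ⟨by linarith, by linarith [abs_le_of_sq_le_sq' h1 h3]⟩
  · rintro ⟨h1, h2⟩
    exact ⟨pow_le_pow_left₀ hn (by linarith) 2, by linarith, by linarith⟩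

theorem continuous_lam1 : Continuous (lam1 : Block d → ℝ) := by
  unfold lam1; fun_prop

theorem continuous_lam2 : Continuous (lam2 : Block d → ℝ) := by
  unfold lam2
  have := continuous_tailNorm (d := d)
  fun_prop

/-- The unit `(1, 0, …, 0)` of a block. -/
def unitBlock (d : ℕ) : Block d := fun i => if i = 0 then 1 else 0

theorem lam1_sub_smul_unit (x : Block d) (r : ℝ) : lam1 (x - r • unitBlock d) = lam1 x - r := by
  simp [lam1, unitBlock]; ring

theorem lam2_sub_smul_unit (x : Block d) (r : ℝ) : lam2 (x - r • unitBlock d) = lam2 x - r := by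
  have : tailNorm (x - r • unitBlock d) = tailNorm x := by
    simp [tailNorm, unitBlock]
  simp [lam2, this]
  simp [unitBlock]; ring

theorem mem_interior_cone_iff (x : Block d) :
    x ∈ interior (cone d) ↔ 0 < lam1 x ∧ 0 < lam2 x := by
  constructor
  · intro hx
    -- Subtracting a small multiple of the unit stays in the cone and lowers every eigenvalue by the
    -- same amount, so the eigenvalues were positive.
    have hcont : ContinuousAt (fun r : ℝ => x - r • unitBlock d) 0 := by fun_prop
    have h0 : interior (cone d) ∈ 𝓝 (x - (0 : ℝ) • unitBlock d) := by
      simpa using isOpen_interior.mem_nhds hx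
    have hev : ∀ᶠ r : ℝ in 𝓝[>] 0, x - r • unitBlock d ∈ interior (cone d) :=
      (hcont.eventually h0).filter_mono nhdsWithin_le_nhds
    obtain ⟨r, hr, hr0⟩ := (hev.and self_mem_nhdsWithin).exists
    have hr0 : 0 < r := hr0
    have := (mem_cone_iff _).1 (interior_subset hr)
    rw [lam1_sub_smul_unit, lam2_sub_smul_unit] at this
    exact ⟨by linarith, by linarith⟩
  · intro hx
    refine mem_interior.2 ⟨{y | 0 < lam1 y} ∩ {y | 0 < lam2 y}, ?_, ?_, hx⟩
    · exact fun y hy => (mem_cone_iff y).2 ⟨le_of_lt hy.1, le_of_lt hy.2⟩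
    · exact (isOpen_lt continuous_const continuous_lam1).inter
        (isOpen_lt continuous_const continuous_lam2)

/-- The interior of the cone in terms of the determinant. -/
theorem mem_interior_cone_iff_lorDet (x : Block d) :
    x ∈ interior (cone d) ↔ 0 < lam1 x ∧ 0 < lorDet x ∧ 0 < x 0 + x 1 := by
  rw [mem_interior_cone_iff, ← lam2_mul_lam4]
  have h := lam2_le_lam4 x
  have hp : lam2 x + lam4 x = 2 * (x 0 + x 1) := by unfold lam2 lam4; ring
  refine and_congr_right fun _ => ⟨fun h2 => ⟨mul_pos h2 (h2.trans_le h), by linarith⟩, ?_⟩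
  rintro ⟨h1, h2⟩
  by_contra! h3
  nlinarith

theorem mem_cone_iff_lorDet (x : Block d) :
    x ∈ cone d ↔ 0 ≤ lam1 x ∧ 0 ≤ lorDet x ∧ 0 ≤ x 0 + x 1 := by
  simp only [cone, mem_ofPred_eq, lam1, lorDet, sub_nonneg]
  tauto

theorem lam1_smul (r : ℝ) (x : Block d) : lam1 (r • x) = r * lam1 x := by
  simp [lam1]; ring

theorem lorDet_smul (r : ℝ) (x : Block d) : lorDet (r • x) = r ^ 2 * lorDet x := by
  simp [lorDet, mul_pow, ← Finset.mul_sum]; ring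

theorem lam2_smul {r : ℝ} (hr : 0 ≤ r) (x : Block d) : lam2 (r • x) = r * lam2 x := by
  simp [lam2, tailNorm_smul, abs_of_nonneg hr]; ring

theorem lam4_smul {r : ℝ} (hr : 0 ≤ r) (x : Block d) : lam4 (r • x) = r * lam4 x := by
  simp [lam4, tailNorm_smul, abs_of_nonneg hr]; ring

theorem smul_mem_interior_cone {r : ℝ} (hr : 0 < r) {x : Block d} (hx : x ∈ interior (cone d)) :
    r • x ∈ interior (cone d) := by
  rw [mem_interior_cone_iff] at hx ⊢
  rw [lam1_smul, lam2_smul hr.le]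
  exact ⟨mul_pos hr hx.1, mul_pos hr hx.2⟩

theorem smul_mem_cone {r : ℝ} (hr : 0 ≤ r) {x : Block d} (hx : x ∈ cone d) :
    r • x ∈ cone d := by
  rw [mem_cone_iff] at hx ⊢
  rw [lam1_smul, lam2_smul hr]
  exact ⟨mul_nonneg hr hx.1, mul_nonneg hr hx.2⟩

theorem jordanTrace_spectralMap (φ : ℝ → ℝ) (x : Block d) :
    jordanTrace (spectralMap φ x) = φ (lam1 x) + (φ (lam2 x) + φ (lam4 x)) / 2 := by
  simp [jordanTrace, spectralMap, frame1, frame2, frame4]; ring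

theorem lam1_spectralMap (φ : ℝ → ℝ) (x : Block d) : lam1 (spectralMap φ x) = φ (lam1 x) := by
  simp [lam1, spectralMap, frame1, frame2, frame4]; ring

theorem spectralMap_zero_add_one (φ : ℝ → ℝ) (x : Block d) :
    spectralMap φ x 0 + spectralMap φ x 1 = (φ (lam2 x) + φ (lam4 x)) / 2 := by
  simp [spectralMap, frame1, frame2, frame4]; ring

theorem spectralMap_tail (φ : ℝ → ℝ) (x : Block d) (i : Fin d) :
    spectralMap φ x i.succ.succ =
      (φ (lam4 x) - φ (lam2 x)) / (2 * √2 * tailNorm x) * x i.succ.succ := by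
  simp [spectralMap, frame1, frame2, frame4]; ring

theorem lorInner_spectralMap (φ : ℝ → ℝ) (x s : Block d) :
    lorInner (spectralMap φ x) s = (φ (lam2 x) + φ (lam4 x)) / 2 * (s 0 + s 1) +
      (φ (lam4 x) - φ (lam2 x)) / (√2 * tailNorm x) *
        ∑ i : Fin d, x i.succ.succ * s i.succ.succ := by
  simp only [lorInner, spectralMap_zero_add_one, spectralMap_tail, mul_assoc, ← Finset.mul_sum]
  congr 1
  rw [← mul_assoc, ← mul_div_assoc, mul_div_mul_left _ _ (two_ne_zero)]

theorem lam4_eq_lam2 {x : Block d} (hx : tailNorm x = 0) : lam4 x = lam2 x := by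
  simp [lam4, lam2, hx]

/-- The cosine of the angle between the tails. -/
theorem exists_cos (x s : Block d) : ∃ c : ℝ, -1 ≤ c ∧ c ≤ 1 ∧
    ∑ i : Fin d, x i.succ.succ * s i.succ.succ = c * tailNorm x * tailNorm s := by
  have h := abs_sum_tail_le x s
  by_cases h0 : tailNorm x * tailNorm s = 0
  -- If a tail vanishes, both sides are zero and any cosine would do.
  · refine ⟨0, by norm_num, by norm_num, ?_⟩
    rw [h0] at h
    simpa using h
  · have hpos : 0 < tailNorm x * tailNorm s :=
      (mul_nonneg (tailNorm_nonneg x) (tailNorm_nonneg s)).lt_of_ne' h0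
    rw [abs_le] at h
    refine ⟨(∑ i : Fin d, x i.succ.succ * s i.succ.succ) / (tailNorm x * tailNorm s), ?_, ?_, ?_⟩
    · rw [le_div_iff₀ hpos]; linarith
    · rw [div_le_iff₀ hpos]; linarith
    · rw [mul_assoc, div_mul_cancel₀ _ h0]

/-- Removes the division by the norm of the tail; a zero tail causes no harm because `lam4` and
`lam2` then agree. -/
theorem lorInner_spectralMap_cos (φ : ℝ → ℝ) {x s : Block d} {c : ℝ}
    (hc : ∑ i : Fin d, x i.succ.succ * s i.succ.succ = c * tailNorm x * tailNorm s) :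
    lorInner (spectralMap φ x) s = (φ (lam2 x) + φ (lam4 x)) / 2 * (s 0 + s 1) +
      (φ (lam4 x) - φ (lam2 x)) / 2 * (c * (√2 * tailNorm s)) := by
  rw [lorInner_spectralMap, hc]
  by_cases hx : tailNorm x = 0
  · simp [lam4_eq_lam2 hx]
  · have h2 : √2 * √2 = 2 := Real.mul_self_sqrt zero_le_two
    have h0 : √2 ≠ 0 := by positivity
    congr 1
    field_simp
    linear_combination -(φ (lam4 x) - φ (lam2 x)) * c * tailNorm s * h2

theorem lorInner_add_right (x s t : Block d) :
    lorInner x (s + t) = lorInner x s + lorInner x t := by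
  simp only [lorInner, Pi.add_apply, mul_add, Finset.sum_add_distrib]; ring

theorem lorInner_comm (x s : Block d) : lorInner x s = lorInner s x := by
  simp only [lorInner, mul_comm]

theorem lorInner_self_spectralMap (φ : ℝ → ℝ) (x : Block d) :
    lorInner (spectralMap φ x) (spectralMap φ x) = (φ (lam2 x) ^ 2 + φ (lam4 x) ^ 2) / 2 := by
  have h : ∑ i : Fin d, x i.succ.succ * x i.succ.succ = 1 * tailNorm x * tailNorm x := by
    rw [one_mul, ← sq, tailNorm_sq]
    exact Finset.sum_congr rfl fun i _ => by ring
  have h2 : √2 * √2 = 2 := Real.mul_self_sqrt zero_le_two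
  by_cases hx : tailNorm x = 0
  · rw [lorInner_spectralMap]
    simp [lam4_eq_lam2 hx, spectralMap_zero_add_one]; ring
  · have h0 : √2 ≠ 0 := by positivity
    rw [lorInner_spectralMap, spectralMap_zero_add_one]
    simp only [spectralMap_tail, mul_left_comm (x _), ← Finset.mul_sum, h]
    field_simp
    linear_combination -(φ (lam4 x) - φ (lam2 x)) ^ 2 * h2

theorem dotProduct_self_spectralMap (φ : ℝ → ℝ) (x : Block d) :
    spectralMap φ x ⬝ᵥ spectralMap φ x =
      (φ (lam1 x) ^ 2 + (φ (lam2 x) ^ 2 + φ (lam4 x) ^ 2) / 2) / 2 := by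
  rw [dotProduct_eq, lorInner_self_spectralMap, lam1_spectralMap]; ring

/-- Second order upper bound for the trace of a kernel function. -/
theorem jordanTrace_le_taylor {ψ : ℝ → ℝ} (h : IsEligibleKernel ψ) {l : ℝ} (hl : 0 < l)
    {v a : Block d} (hv1 : l ≤ lam1 v) (hv2 : l ≤ lam2 v) (ha1 : l ≤ lam1 a) (ha2 : l ≤ lam2 a) :
    jordanTrace (spectralMap ψ a) ≤ jordanTrace (spectralMap ψ v) +
      2 * (spectralMap (deriv ψ) v ⬝ᵥ (a - v)) +
      deriv (deriv ψ) l * ((a - v) ⬝ᵥ (a - v)) := by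
  have hv4 := hv2.trans (lam2_le_lam4 v)
  have ha4 := ha2.trans (lam2_le_lam4 a)
  obtain ⟨c, hc1, hc2, hc⟩ := exists_cos v a
  have hvv : ∑ i : Fin d, v i.succ.succ * v i.succ.succ = 1 * tailNorm v * tailNorm v := by
    rw [one_mul, ← sq, tailNorm_sq]
    exact Finset.sum_congr rfl fun i _ => by ring
  have e1 : spectralMap (deriv ψ) v ⬝ᵥ (a - v) =
      spectralMap (deriv ψ) v ⬝ᵥ a - spectralMap (deriv ψ) v ⬝ᵥ v := dotProduct_sub _ _ _
  have e2 : (a - v) ⬝ᵥ (a - v) = a ⬝ᵥ a + v ⬝ᵥ v - 2 * (v ⬝ᵥ a) := by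
    simp only [dotProduct_sub, sub_dotProduct, dotProduct_comm a v]; ring
  have e3 : lorInner v a =
      (v 0 + v 1) * (a 0 + a 1) + c * (√2 * tailNorm v) * (√2 * tailNorm a) := by
    have h2 : √2 * √2 = 2 := Real.mul_self_sqrt zero_le_two
    rw [lorInner, hc]; linear_combination - c * tailNorm v * tailNorm a * h2
  rw [e1, e2, dotProduct_eq, dotProduct_eq, dotProduct_eq, dotProduct_eq, dotProduct_eq,
    lorInner_self, lorInner_self, e3, lorInner_spectralMap_cos _ hc,
    lorInner_spectralMap_cos _ hvv, lam1_spectralMap, jordanTrace_spectralMap,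
    jordanTrace_spectralMap]
  -- The weights (1 ± c)/4 are the overlaps of the two spectral frames: one scalar Taylor bound for
  -- each pair of an eigenvalue of v and one of a. The weights belonging to one eigenvalue add up to
  -- 1/2, its weight in the trace.
  have t1 := h.le_taylor hl ha1 hv1
  have t22 := mul_le_mul_of_nonneg_left (h.le_taylor hl ha2 hv2)
    (by linarith : (0 : ℝ) ≤ (1 + c) / 4)
  have t44 := mul_le_mul_of_nonneg_left (h.le_taylor hl ha4 hv4)
    (by linarith : (0 : ℝ) ≤ (1 + c) / 4)
  have t24 := mul_le_mul_of_nonneg_left (h.le_taylor hl ha2 hv4)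
    (by linarith : (0 : ℝ) ≤ (1 - c) / 4)
  have t42 := mul_le_mul_of_nonneg_left (h.le_taylor hl ha4 hv2)
    (by linarith : (0 : ℝ) ≤ (1 - c) / 4)
  generalize deriv (deriv ψ) l = M at *
  generalize deriv ψ (lam2 v) = D2 at *
  generalize deriv ψ (lam4 v) = D4 at *
  generalize deriv ψ (lam1 v) = D1 at *
  generalize ψ (lam2 v) = v2 at *
  generalize ψ (lam4 v) = v4 at *
  generalize ψ (lam1 v) = v1 at *
  generalize ψ (lam2 a) = a2 at *
  generalize ψ (lam4 a) = a4 at *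
  generalize ψ (lam1 a) = a1 at *
  unfold lam2 lam4 at *
  generalize √2 * tailNorm v = S at *
  generalize √2 * tailNorm a = T at *
  generalize v 0 + v 1 = pv at *
  generalize a 0 + a 1 = pa at *
  generalize lam1 v = uv at *
  generalize lam1 a = ua at *
  linear_combination t1 + t22 + t44 + t24 + t42

/-- The factor 2 is not sharp for `lam1`; it is the one needed for `lam2`, whose square enters the
squared norm with weight 1/4. -/
theorem sub_le_lam1_add {r : ℝ} (hr : 0 ≤ r) (v w : Block d) (hw : w ⬝ᵥ w ≤ r ^ 2) :
    lam1 v - 2 * r ≤ lam1 (v + w) := by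
  rw [dotProduct_eq, lorInner_self] at hw
  have h1 : lam1 w ^ 2 ≤ (2 * r) ^ 2 := by
    nlinarith [sq_nonneg (lam2 w), sq_nonneg (lam4 w)]
  have h2 := (abs_le_of_sq_le_sq' h1 (by linarith)).1
  have h3 : lam1 (v + w) = lam1 v + lam1 w := by simp [lam1]; ring
  linarith

theorem sub_le_lam2_add {r : ℝ} (hr : 0 ≤ r) (v w : Block d) (hw : w ⬝ᵥ w ≤ r ^ 2) :
    lam2 v - 2 * r ≤ lam2 (v + w) := by
  rw [dotProduct_eq, lorInner_self] at hw
  have h1 : lam2 w ^ 2 ≤ (2 * r) ^ 2 := by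
    nlinarith [sq_nonneg (lam1 w), sq_nonneg (lam4 w)]
  have h2 := (abs_le_of_sq_le_sq' h1 (by linarith)).1
  have h3 : lam2 v + lam2 w ≤ lam2 (v + w) := by
    have := mul_le_mul_of_nonneg_left (tailNorm_add_le v w) (Real.sqrt_nonneg 2)
    simp only [lam2, Pi.add_apply]; linarith
  linarith

/-- Comparison of the trace at a geometric mean with the mean of the traces. -/
theorem jordanTrace_le_mean {ψ : ℝ → ℝ} (h : IsEligibleKernel ψ) {v a b : Block d}
    (hv : v ∈ interior (cone d)) (ha : a ∈ interior (cone d)) (hb : b ∈ interior (cone d))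
    (h1 : lam1 v ^ 2 = lam1 a * lam1 b) (hdet : lorDet v ^ 2 = lorDet a * lorDet b)
    (hdot : v ⬝ᵥ v = a ⬝ᵥ b) :
    jordanTrace (spectralMap ψ v) ≤
      (jordanTrace (spectralMap ψ a) + jordanTrace (spectralMap ψ b)) / 2 := by
  rw [mem_interior_cone_iff] at hv ha hb
  have hv4 := hv.2.trans_le (lam2_le_lam4 v)
  have ha4 := ha.2.trans_le (lam2_le_lam4 a)
  have hb4 := hb.2.trans_le (lam2_le_lam4 b)
  rw [dotProduct_eq, dotProduct_eq, lorInner_self] at hdot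
  have hle := lorInner_le a b
  simp only [← lam2_mul_lam4] at hdet
  have hab2 : 0 < lam2 a * lam2 b := mul_pos ha.2 hb.2
  have hab4 : 0 < lam4 a * lam4 b := mul_pos ha4 hb4
  -- The geometric means of equally ordered eigenvalues. The pairs (`lam2 v`, `lam4 v`) and (m, n)
  -- have the same product, by the determinants, and the sum of squares of the first is at most that
  -- of the second, so (m, n) is the more spread out pair.
  set m := √(lam2 a * lam2 b)
  set n := √(lam4 a * lam4 b)
  have hm : 0 < m := Real.sqrt_pos.2 hab2
  have hn : 0 < n := Real.sqrt_pos.2 hab4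
  have hm2 : m ^ 2 = lam2 a * lam2 b := Real.sq_sqrt hab2.le
  have hn2 : n ^ 2 = lam4 a * lam4 b := Real.sq_sqrt hab4.le
  have hmn : m ≤ n := Real.sqrt_le_sqrt
    (mul_le_mul (lam2_le_lam4 a) (lam2_le_lam4 b) hb.2.le ha4.le)
  have hsum : lam2 v ^ 2 + lam4 v ^ 2 ≤ m ^ 2 + n ^ 2 := by rw [hm2, hn2]; linarith
  have hprod : lam4 v * lam2 v = m * n := by
    have : (lam4 v * lam2 v) ^ 2 = (m * n) ^ 2 := by
      rw [mul_pow m, hm2, hn2]; linarith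
    exact (pow_left_inj₀ (mul_pos hv4 hv.2).le (mul_pos hm hn).le two_ne_zero).1 this
  have hv4n : lam4 v ≤ n := by
    -- If `lam4 v` exceeded n ≥ m, then (`lam4 v`² - m²)(`lam4 v`² - n²) would be positive, against
    -- the bound on the sum of squares at equal product.
    by_contra! hlt
    have k1 : n ^ 2 < lam4 v ^ 2 := pow_lt_pow_left₀ hlt hn.le two_ne_zero
    have k2 : m ^ 2 < lam4 v ^ 2 := (pow_le_pow_left₀ hm.le hmn 2).trans_lt k1
    have k3 := mul_pos (sub_pos.2 k1) (sub_pos.2 k2)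
    have k4 : (lam4 v * lam2 v) ^ 2 = (m * n) ^ 2 := by rw [hprod]
    nlinarith [mul_le_mul_of_nonneg_left hsum (sq_nonneg (lam4 v))]
  have hmv4 : m ≤ lam4 v := by
    apply le_of_sq_le_sq _ hv4.le
    nlinarith [mul_le_mul_of_nonneg_left (lam2_le_lam4 v) hv4.le,
      mul_le_mul_of_nonneg_left hmn hm.le]
  have k := h.add_le_add_of_mul_eq hm hmv4 hv4n hv.2 hprod
  have k1 := h.map_le_of_sq_eq ha.1 hb.1 hv.1 h1
  have k2 := h.map_le_of_sq_eq ha.2 hb.2 hm hm2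
  have k4 := h.map_le_of_sq_eq ha4 hb4 hn hn2
  simp only [jordanTrace_spectralMap]
  linarith

end Block

/-! ### Symmetric matrices. -/

theorem eq_zero_of_eigenvalues {n : Type*} [Fintype n] [DecidableEq n] {M : Matrix n n ℝ}
    (hM : M.IsHermitian) (h : ∀ (u : n → ℝ) (r : ℝ), u ≠ 0 → M *ᵥ u = r • u → r = 0) :
    M = 0 := by
  rw [← hM.eigenvalues_eq_zero_iff]
  funext i
  refine h _ _ (fun h0 => ?_) (hM.mulVec_eigenvectorBasis i)
  have := hM.eigenvectorBasis.orthonormal.ne_zero i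
  exact this (by ext j; exact congrFun h0 j)

/-- From V(V-W) + (V-W)W = V² - W² = 0, an eigenvector u of V-W with eigenvalue r satisfies r(uᵀVu +
uᵀWu) = 0, which forces r = 0. -/
theorem posDef_eq_of_mul_self_eq {n : Type*} [Fintype n] [DecidableEq n] {V W : Matrix n n ℝ}
    (hV : V.PosDef) (hW : W.PosDef) (h : V * V = W * W) : V = W := by
  rw [← sub_eq_zero]
  refine eq_zero_of_eigenvalues (hV.isHermitian.sub hW.isHermitian) fun u r hu hr => ?_
  have e : V * (V - W) + (V - W) * W = 0 := by
    rw [mul_sub, sub_mul, h]; abel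
  have hsymm : (V - W)ᵀ = V - W := by
    have := (hV.isHermitian.sub hW.isHermitian).eq
    rwa [conjTranspose_eq_transpose_of_trivial] at this
  have e1 : u ⬝ᵥ ((V * (V - W) + (V - W) * W) *ᵥ u) = r * (u ⬝ᵥ (V *ᵥ u) + u ⬝ᵥ (W *ᵥ u)) := by
    rw [add_mulVec, ← mulVec_mulVec, ← mulVec_mulVec, hr, dotProduct_add, mulVec_smul,
      dotProduct_smul, dotProduct_mulVec u (V - W), ← mulVec_transpose, hsymm, hr,
      smul_dotProduct, smul_eq_mul, smul_eq_mul]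
    ring
  rw [e, zero_mulVec, dotProduct_zero] at e1
  have p1 := hV.dotProduct_mulVec_pos hu
  have p2 := hW.dotProduct_mulVec_pos hu
  simp only [star_trivial] at p1 p2
  rcases mul_eq_zero.1 e1.symm with h0 | h0
  · exact h0
  · linarith

/-! ### Cone automorphisms and the Nesterov–Todd scaling of a block. -/

section Block

variable {d : ℕ}

theorem block_ext {x s : Block d} (h1 : lam1 x = lam1 s) (h2 : x 0 + x 1 = s 0 + s 1)
    (h3 : ∀ i : Fin d, x i.succ.succ = s i.succ.succ) : x = s := by
  unfold lam1 at h1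
  ext i
  refine Fin.cases (by linarith) (fun i => Fin.cases ?_ h3 i) i
  rw [Fin.succ_zero_eq_one]
  linarith

theorem isClosed_cone : IsClosed (cone d) := by
  have : cone d = {x | 0 ≤ lam1 x} ∩ {x | 0 ≤ lam2 x} := by
    ext x; exact mem_cone_iff x
  rw [this]
  exact (isClosed_le continuous_const continuous_lam1).inter
    (isClosed_le continuous_const continuous_lam2)

theorem eq_zero_of_mem_cone {u : Block d} (h : u ∈ cone d) (h' : -u ∈ cone d) : u = 0 := by
  rw [mem_cone_iff] at h h'
  simp only [lam1, lam2, tailNorm_neg, Pi.neg_apply] at h h'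
  have hn := mul_nonneg (Real.sqrt_nonneg 2) (tailNorm_nonneg u)
  have hn0 : √2 * tailNorm u = 0 := by linarith
  have ht := sqrt_two_mul_tailNorm_sq u
  rw [hn0] at ht
  have ht' : ∑ i : Fin d, u i.succ.succ ^ 2 = 0 := by linarith
  rw [Finset.sum_eq_zero_iff_of_nonneg fun i _ => sq_nonneg _] at ht'
  refine block_ext ?_ ?_ fun i => ?_
  · simp [lam1]; linarith
  · simp; linarith
  · simpa using ht' i (Finset.mem_univ i)

/-- If `v + rᵏ w` stays in the cone for a fixed `r > 1`, then `w` is in the cone. -/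
theorem mem_cone_of_pow {v w : Block d} {r : ℝ} (hr : 1 < r)
    (h : ∀ k : ℕ, v + r ^ k • w ∈ cone d) : w ∈ cone d := by
  have h1 : ∀ k : ℕ, (r⁻¹) ^ k • v + w ∈ cone d := by
    intro k
    have := smul_mem_cone (pow_nonneg (inv_nonneg.2 (zero_le_one.trans hr.le)) k) (h k)
    rwa [smul_add, smul_smul, ← mul_pow, inv_mul_cancel₀ (by linarith), one_pow, one_smul] at this
  have h2 : Tendsto (fun k : ℕ => (r⁻¹) ^ k • v + w) atTop (𝓝 ((0 : ℝ) • v + w)) :=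
    ((tendsto_pow_atTop_nhds_zero_of_lt_one (inv_nonneg.2 (zero_le_one.trans hr.le))
      (inv_lt_one_of_one_lt₀ hr)).smul_const v).add_const w
  rw [zero_smul, zero_add] at h2
  exact isClosed_cone.mem_of_tendsto h2 (Eventually.of_forall h1)

/-- For small t of either sign v + tu is in the cone, and applying M repeatedly gives v + rᵏtu in
the cone. If r > 1, then both tu and -tu lie in the cone, which contains no line. -/
theorem eigenvalue_le_one {M : Matrix (Fin (d + 2)) (Fin (d + 2)) ℝ}
    (hM : ∀ u ∈ cone d, M *ᵥ u ∈ cone d) {v : Block d} (hv : v ∈ interior (cone d))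
    (hMv : M *ᵥ v = v) {u : Block d} (hu : u ≠ 0) {r : ℝ} (hr : M *ᵥ u = r • u) : r ≤ 1 := by
  by_contra! hr1
  have hcont : ContinuousAt (fun t : ℝ => v + t • u) 0 := by fun_prop
  have h0 : cone d ∈ 𝓝 (v + (0 : ℝ) • u) := by
    simpa using mem_interior_iff_mem_nhds.1 hv
  obtain ⟨e, he, hball⟩ := Metric.eventually_nhds_iff.1 (hcont.eventually h0)
  have key : ∀ t : ℝ, |t| < e → t • u ∈ cone d := by
    intro t ht
    refine mem_cone_of_pow (v := v) hr1 fun k => ?_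
    induction k with
    | zero =>
      have := hball (y := t) (by simpa using ht)
      rwa [pow_zero, one_smul]
    | succ k ih =>
      have := hM _ ih
      rw [mulVec_add, hMv, mulVec_smul, mulVec_smul, hr] at this
      convert this using 2
      simp only [smul_smul]; ring_nf
  have hp := key (e / 2) (by rw [abs_of_pos] <;> linarith)
  have hm := key (-(e / 2)) (by rw [abs_neg, abs_of_pos] <;> linarith)
  rw [neg_smul] at hm
  rcases smul_eq_zero.1 (eq_zero_of_mem_cone hp hm) with h | h
  · linarith
  · exact hu h

/-- A positive definite automorphism of the cone with an interior fixed point is trivial. -/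
theorem eq_one_of_fixed {M : Matrix (Fin (d + 2)) (Fin (d + 2)) ℝ} (hpd : M.PosDef)
    (hM : ∀ u ∈ cone d, M *ᵥ u ∈ cone d) (hM' : ∀ u ∈ cone d, M⁻¹ *ᵥ u ∈ cone d)
    {v : Block d} (hv : v ∈ interior (cone d)) (hMv : M *ᵥ v = v) : M = 1 := by
  rw [← sub_eq_zero]
  refine eq_zero_of_eigenvalues (hpd.isHermitian.sub isHermitian_one) fun u r hu hr => ?_
  rw [sub_mulVec, one_mulVec, sub_eq_iff_eq_add] at hr
  have hr : M *ᵥ u = (r + 1) • u := by rw [hr, add_smul, one_smul]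
  have hdet : IsUnit M.det := (isUnit_iff_isUnit_det M).1 hpd.isUnit
  have hinv : ∀ w, M⁻¹ *ᵥ (M *ᵥ w) = w := fun w => by
    rw [mulVec_mulVec, nonsing_inv_mul _ hdet, one_mulVec]
  have h1 := eigenvalue_le_one hM hv hMv hu hr
  have hMv' : M⁻¹ *ᵥ v = v := by
    have := hinv v
    rwa [hMv] at this
  have hpos : 0 < r + 1 := by
    have := hpd.dotProduct_mulVec_pos hu
    rw [hr, dotProduct_smul, star_trivial, smul_eq_mul] at this
    have h0 : 0 ≤ u ⬝ᵥ u := by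
      simpa using dotProduct_star_self_nonneg u
    by_contra! hneg
    nlinarith
  have hr' : M⁻¹ *ᵥ u = (r + 1)⁻¹ • u := by
    have := hinv u
    rw [hr, mulVec_smul] at this
    rw [← this, smul_smul, inv_mul_cancel₀ hpos.ne', one_smul, this]
  -- An eigenvalue of M and its reciprocal are both at most 1.
  have h2 := eigenvalue_le_one hM' hv hMv' hu hr'
  rw [inv_le_one₀ hpos] at h2
  linarith

/-- A block given by `x₁ - x₂`, `x₁ + x₂` and the tail. -/
noncomputable def mkBlock (u p : ℝ) (t : Fin d → ℝ) : Block d :=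
  vecCons ((u + p) / 2) (vecCons ((p - u) / 2) t)

@[simp] theorem lam1_mkBlock (u p : ℝ) (t : Fin d → ℝ) : lam1 (mkBlock u p t) = u := by
  simp [lam1, mkBlock]; ring

@[simp] theorem mkBlock_zero_add_one (u p : ℝ) (t : Fin d → ℝ) :
    mkBlock u p t 0 + mkBlock u p t 1 = p := by
  simp [mkBlock]; ring

@[simp] theorem mkBlock_tail (u p : ℝ) (t : Fin d → ℝ) (i : Fin d) :
    mkBlock u p t i.succ.succ = t i := by
  simp [mkBlock]

theorem lorInner_smul_right (r : ℝ) (x s : Block d) : lorInner x (r • s) = r * lorInner x s := by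
  simp only [lorInner, Pi.smul_apply, smul_eq_mul, mul_left_comm _ r, ← Finset.mul_sum]; ring

theorem lam1_add (x s : Block d) : lam1 (x + s) = lam1 x + lam1 s := by
  simp [lam1]; ring

/-- Multiplication by `α` on `x₁ - x₂` and `η` times the quadratic representation of `y` on the
Lorentz part. -/
noncomputable def boostFun (α η : ℝ) (y u : Block d) : Block d :=
  mkBlock (α * lam1 u) (η * (2 * lorInner y u * (y 0 + y 1) - (u 0 + u 1)))
    (fun i => η * (2 * lorInner y u * y i.succ.succ + u i.succ.succ))

theorem boostFun_zero_add_one (α η : ℝ) (y u : Block d) :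
    boostFun α η y u 0 + boostFun α η y u 1 =
      η * (2 * lorInner y u * (y 0 + y 1) - (u 0 + u 1)) :=
  mkBlock_zero_add_one _ _ _

/-- `boostFun` as a linear map. -/
noncomputable def boost (α η : ℝ) (y : Block d) : Block d →ₗ[ℝ] Block d where
  toFun := boostFun α η y
  map_add' u w := by
    refine block_ext ?_ ?_ fun i => ?_
    · simp only [lam1_add, boostFun, lam1_mkBlock]; ring
    · have hu := boostFun_zero_add_one α η y u
      have hw := boostFun_zero_add_one α η y w
      rw [boostFun_zero_add_one, lorInner_add_right]
      simp only [Pi.add_apply]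
      linear_combination - hu - hw
    · simp only [lorInner_add_right, boostFun, mkBlock_tail, Pi.add_apply]; ring
  map_smul' r u := by
    refine block_ext ?_ ?_ fun i => ?_
    · simp only [lam1_smul, boostFun, lam1_mkBlock, RingHom.id_apply]; ring
    · have hu := boostFun_zero_add_one α η y u
      rw [boostFun_zero_add_one, lorInner_smul_right]
      simp only [Pi.smul_apply, RingHom.id_apply, smul_eq_mul]
      linear_combination - r * hu
    · simp only [lorInner_smul_right, boostFun, mkBlock_tail, Pi.smul_apply, RingHom.id_apply,
        smul_eq_mul]; ring

theorem lam1_boost (α η : ℝ) (y u : Block d) : lam1 (boost α η y u) = α * lam1 u :=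
  lam1_mkBlock _ _ _

theorem boost_zero_add_one (α η : ℝ) (y u : Block d) :
    boost α η y u 0 + boost α η y u 1 = η * (2 * lorInner y u * (y 0 + y 1) - (u 0 + u 1)) :=
  boostFun_zero_add_one α η y u

theorem boost_tail (α η : ℝ) (y u : Block d) (i : Fin d) :
    boost α η y u i.succ.succ = η * (2 * lorInner y u * y i.succ.succ + u i.succ.succ) := by
  change boostFun α η y u i.succ.succ = _
  rw [boostFun, mkBlock_tail]

theorem sum_boost_tail_mul (α η : ℝ) (y u w : Block d) :
    ∑ i : Fin d, boost α η y u i.succ.succ * w i.succ.succ =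
      η * (2 * lorInner y u * ∑ i : Fin d, y i.succ.succ * w i.succ.succ +
        ∑ i : Fin d, u i.succ.succ * w i.succ.succ) := by
  simp only [boost_tail, Finset.mul_sum, ← Finset.sum_add_distrib]
  exact Finset.sum_congr rfl fun i _ => by ring

theorem dotProduct_boost_comm (α η : ℝ) (y u w : Block d) :
    boost α η y u ⬝ᵥ w = u ⬝ᵥ boost α η y w := by
  rw [dotProduct_comm u, dotProduct_eq, dotProduct_eq, lam1_boost, lam1_boost]
  have e : ∀ a b : Block d, lorInner (boost α η y a) b =
      η * (2 * lorInner y a * lorInner y b - ((a 0 + a 1) * (b 0 + b 1) -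
        2 * ∑ i : Fin d, a i.succ.succ * b i.succ.succ)) := by
    intro a b
    rw [lorInner, boost_zero_add_one, sum_boost_tail_mul]
    conv_rhs => rw [show lorInner y b = (y 0 + y 1) * (b 0 + b 1) +
      2 * ∑ i : Fin d, y i.succ.succ * b i.succ.succ from rfl]
    ring
  rw [e, e]
  simp only [mul_comm (w _)]
  ring

theorem lorDet_eq (x : Block d) : lorDet x =
    (x 0 + x 1) ^ 2 - 2 * ∑ i : Fin d, x i.succ.succ * x i.succ.succ := by
  simp only [lorDet, sq]

theorem lorDet_boost (α η : ℝ) {y : Block d} (hy : lorDet y = 1) (u : Block d) :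
    lorDet (boost α η y u) = η ^ 2 * lorDet u := by
  have e1 : ∑ i : Fin d, boost α η y u i.succ.succ * boost α η y u i.succ.succ =
      η ^ 2 * ((2 * lorInner y u) ^ 2 * ∑ i : Fin d, y i.succ.succ * y i.succ.succ +
        2 * (2 * lorInner y u) * ∑ i : Fin d, y i.succ.succ * u i.succ.succ +
        ∑ i : Fin d, u i.succ.succ * u i.succ.succ) := by
    simp only [boost_tail, Finset.mul_sum, ← Finset.sum_add_distrib]
    exact Finset.sum_congr rfl fun i _ => by ring
  have e2 : 2 * ∑ i : Fin d, y i.succ.succ * u i.succ.succ =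
      lorInner y u - (y 0 + y 1) * (u 0 + u 1) := by rw [lorInner]; ring
  rw [lorDet_eq] at hy
  rw [lorDet_eq, lorDet_eq u, e1, boost_zero_add_one]
  linear_combination 4 * η ^ 2 * lorInner y u ^ 2 * hy - 4 * η ^ 2 * lorInner y u * e2

/-- The reflection `(x₁ + x₂, x₃, …) ↦ (x₁ + x₂, -x₃, …)` of the Lorentz part. -/
noncomputable def reflect (y : Block d) : Block d :=
  mkBlock (lam1 y) (y 0 + y 1) (fun i => -y i.succ.succ)

theorem lorDet_reflect (y : Block d) : lorDet (reflect y) = lorDet y := by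
  simp [lorDet, reflect]

theorem reflect_zero_add_one (y : Block d) : reflect y 0 + reflect y 1 = y 0 + y 1 :=
  mkBlock_zero_add_one _ _ _

theorem reflect_tail (y : Block d) (i : Fin d) : reflect y i.succ.succ = -y i.succ.succ :=
  mkBlock_tail _ _ _ _

/-- At determinant 1 the reflection of y is its Jordan inverse in the Lorentz part, and the
quadratic representation of the inverse is the inverse. -/
theorem boost_reflect_boost {α η : ℝ} (hα : α ≠ 0) (hη : η ≠ 0) {y : Block d} (hy : lorDet y = 1)
    (u : Block d) : boost α⁻¹ η⁻¹ (reflect y) (boost α η y u) = u := by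
  have e : lorInner (reflect y) (boost α η y u) = η * lorInner y u := by
    rw [lorInner_comm, lorInner, sum_boost_tail_mul, boost_zero_add_one, reflect_zero_add_one]
    simp only [reflect_tail, mul_neg, Finset.sum_neg_distrib]
    rw [lorDet_eq] at hy
    have e2 : 2 * ∑ i : Fin d, u i.succ.succ * y i.succ.succ =
      lorInner y u - (y 0 + y 1) * (u 0 + u 1) := by rw [lorInner_comm, lorInner]; ring
    linear_combination 2 * η * lorInner y u * hy - η * e2
  refine block_ext ?_ ?_ fun i => ?_
  · rw [lam1_boost, lam1_boost, inv_mul_cancel_left₀ hα]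
  · rw [boost_zero_add_one, e, boost_zero_add_one, reflect_zero_add_one]
    field_simp; ring
  · rw [boost_tail, e, boost_tail, reflect_tail]
    field_simp; ring

/-- Boosts preserve the sign of the determinant, so it remains to stay on the positive branch; the
explicit factor serves the interior as well. Reflecting y turns the upper bound `lorInner_le` into
the lower bound `lam2 y * (u 0 + u 1) ≤ lorInner y u`. -/
theorem boost_zero_add_one_ge {y u : Block d} (hy : lorDet y = 1) (hy0 : 0 < y 0 + y 1)
    (hu : u ∈ cone d) :
    lam2 y ^ 2 * (u 0 + u 1) ≤ 2 * lorInner y u * (y 0 + y 1) - (u 0 + u 1) := by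
  rw [mem_cone_iff] at hu
  have hp : 2 * (y 0 + y 1) = lam2 y + lam4 y := by unfold lam2 lam4; ring
  have hpu : 2 * (u 0 + u 1) = lam2 u + lam4 u := by unfold lam2 lam4; ring
  have h24 := lam2_mul_lam4 y
  rw [hy] at h24
  have hle := lorInner_le (reflect y) u
  have hT : tailNorm (reflect y) = tailNorm y := by simp [tailNorm, reflect_tail]
  have h1 : lorInner (reflect y) u = 2 * (y 0 + y 1) * (u 0 + u 1) - lorInner y u := by
    simp only [lorInner, reflect_zero_add_one, reflect_tail, neg_mul, Finset.sum_neg_distrib]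
    ring
  have h2 : lam2 (reflect y) = lam2 y := by rw [lam2, lam2, hT, reflect_zero_add_one]
  have h4 : lam4 (reflect y) = lam4 y := by rw [lam4, lam4, hT, reflect_zero_add_one]
  rw [h1, h2, h4] at hle
  have h42 := lam2_le_lam4 y
  have hp' : y 0 + y 1 = (lam2 y + lam4 y) / 2 := by linarith
  have hpu' : u 0 + u 1 = (lam2 u + lam4 u) / 2 := by linarith
  have hB : lam2 y * (u 0 + u 1) ≤ lorInner y u := by
    rw [hp', hpu'] at hle
    rw [hpu']
    nlinarith [mul_nonneg (sub_nonneg.2 h42) hu.2]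
  have h5 := mul_le_mul_of_nonneg_right hB hy0.le
  have h6 : 2 * (lam2 y * (u 0 + u 1) * (y 0 + y 1)) = (lam2 y ^ 2 + 1) * (u 0 + u 1) := by
    rw [hp']; linear_combination (u 0 + u 1) * h24
  linarith

theorem boost_mem_cone {α η : ℝ} (hα : 0 < α) (hη : 0 < η) {y u : Block d} (hy : lorDet y = 1)
    (hy0 : 0 < y 0 + y 1) (hu : u ∈ cone d) : boost α η y u ∈ cone d := by
  have hge := boost_zero_add_one_ge hy hy0 hu
  rw [mem_cone_iff_lorDet] at hu ⊢
  rw [lam1_boost, lorDet_boost _ _ hy, boost_zero_add_one]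
  exact ⟨mul_nonneg hα.le hu.1, mul_nonneg (sq_nonneg _) hu.2.1,
    mul_nonneg hη.le ((mul_nonneg (sq_nonneg _) hu.2.2).trans hge)⟩

theorem boost_mem_interior {α η : ℝ} (hα : 0 < α) (hη : 0 < η) {y u : Block d}
    (hy : lorDet y = 1) (hy0 : 0 < y 0 + y 1) (hu : u ∈ interior (cone d)) :
    boost α η y u ∈ interior (cone d) := by
  have hge := boost_zero_add_one_ge hy hy0 (interior_subset hu)
  have hy2 : lam2 y ≠ 0 := fun h => by
    have := lam2_mul_lam4 y
    rw [h, hy, zero_mul] at this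
    exact zero_ne_one this
  rw [mem_interior_cone_iff_lorDet] at hu ⊢
  rw [lam1_boost, lorDet_boost _ _ hy, boost_zero_add_one]
  exact ⟨mul_pos hα hu.1, mul_pos (by positivity) hu.2.1,
    mul_pos hη ((mul_pos (by positivity) hu.2.2).trans_le hge)⟩

noncomputable def boostMatrix (α η : ℝ) (y : Block d) : Matrix (Fin (d + 2)) (Fin (d + 2)) ℝ :=
  LinearMap.toMatrix' (boost α η y)

theorem boostMatrix_mulVec (α η : ℝ) (y u : Block d) :
    boostMatrix α η y *ᵥ u = boost α η y u :=
  LinearMap.toMatrix'_mulVec _ _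

theorem matrix_ext_mulVec {n : Type*} [Fintype n] [DecidableEq n] {M P : Matrix n n ℝ}
    (h : ∀ u, M *ᵥ u = P *ᵥ u) : M = P :=
  Matrix.toLin'.injective (LinearMap.ext fun u => by simpa using h u)

theorem transpose_boostMatrix (α η : ℝ) (y : Block d) :
    (boostMatrix α η y)ᵀ = boostMatrix α η y := by
  refine matrix_ext_mulVec fun u => ?_
  refine dotProduct_eq_iff.1 fun w => ?_
  rw [mulVec_transpose, ← dotProduct_mulVec, boostMatrix_mulVec, boostMatrix_mulVec,
    dotProduct_boost_comm]

theorem boostMatrix_reflect_mul {α η : ℝ} (hα : α ≠ 0) (hη : η ≠ 0) {y : Block d}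
    (hy : lorDet y = 1) : boostMatrix α⁻¹ η⁻¹ (reflect y) * boostMatrix α η y = 1 := by
  refine matrix_ext_mulVec fun u => ?_
  rw [← mulVec_mulVec, boostMatrix_mulVec, boostMatrix_mulVec, boost_reflect_boost hα hη hy,
    one_mulVec]

theorem inv_boostMatrix {α η : ℝ} (hα : α ≠ 0) (hη : η ≠ 0) {y : Block d}
    (hy : lorDet y = 1) : (boostMatrix α η y)⁻¹ = boostMatrix α⁻¹ η⁻¹ (reflect y) :=
  inv_eq_left_inv (boostMatrix_reflect_mul hα hη hy)

/-- Quadratic representations have square roots. -/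
theorem exists_boost_sqrt {z : Block d} (hz : lorDet z = 1) (hz0 : 0 < z 0 + z 1) :
    ∃ r : Block d, lorDet r = 1 ∧ 0 < r 0 + r 1 ∧
      ∀ α η u, boost α η r (boost α η r u) = boost (α ^ 2) (η ^ 2) z u := by
  have hk : 0 < 2 * (1 + (z 0 + z 1)) := by linarith
  set k := √(2 * (1 + (z 0 + z 1)))
  have hk0 : 0 < k := Real.sqrt_pos.2 hk
  have hk2 : k ^ 2 = 2 * (1 + (z 0 + z 1)) := Real.sq_sqrt hk.le
  -- The hyperbolic midpoint of z and the Lorentz unit: k² is the determinant of their sum. The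
  -- `lam1` part of r does not enter the boost, hence the 0.
  set r : Block d := mkBlock 0 ((z 0 + z 1 + 1) / k) (fun i => z i.succ.succ / k)
  have rp : r 0 + r 1 = (z 0 + z 1 + 1) / k := mkBlock_zero_add_one _ _ _
  have rt : ∀ i : Fin d, r i.succ.succ = z i.succ.succ / k := mkBlock_tail _ _ _
  have hr : lorDet r = 1 := by
    simp only [lorDet, rp, rt, div_pow, ← Finset.sum_div] at hz ⊢
    have hk2' : k ^ 2 ≠ 0 := by positivity
    field_simp
    linear_combination hz - hk2
  have zp : z 0 + z 1 = 2 * (r 0 + r 1) ^ 2 - 1 := by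
    rw [rp, div_pow, hk2, eq_sub_iff_add_eq]
    field_simp; ring
  have zt : ∀ i : Fin d, z i.succ.succ = 2 * (r 0 + r 1) * r i.succ.succ := by
    intro i
    have : 2 * (r 0 + r 1) * r i.succ.succ =
      2 * (z 0 + z 1 + 1) / k ^ 2 * z i.succ.succ := by rw [rp, rt]; field_simp
    rw [this, hk2, show 2 * (z 0 + z 1 + 1) = 2 * (1 + (z 0 + z 1)) by ring, div_self hk.ne',
      one_mul]
  refine ⟨r, hr, by rw [rp]; positivity, fun α η u => ?_⟩
  have eB : ∀ u : Block d, 2 * ∑ i : Fin d, r i.succ.succ * u i.succ.succ =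
      lorInner r u - (r 0 + r 1) * (u 0 + u 1) := fun u => by rw [lorInner]; ring
  have ez : lorInner z u = 2 * (r 0 + r 1) * lorInner r u - (u 0 + u 1) := by
    simp only [lorInner, zp, zt, mul_assoc, ← Finset.mul_sum]
    linear_combination 2 * (r 0 + r 1) * eB u - 2 * (r 0 + r 1) * eB u
  have e : lorInner r (boost α η r u) =
      η * ((4 * (r 0 + r 1) ^ 2 - 1) * lorInner r u - 2 * (r 0 + r 1) * (u 0 + u 1)) := by
    rw [lorInner_comm, lorInner, sum_boost_tail_mul, boost_zero_add_one]
    have eu := eB u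
    simp only [mul_comm (u _)]
    rw [lorDet_eq] at hr
    linear_combination η * eu - 2 * η * lorInner r u * hr
  refine block_ext ?_ ?_ fun i => ?_
  · simp only [lam1_boost]; ring
  · simp only [boost_zero_add_one, e, ez, zp]; ring
  · simp only [boost_tail, e, ez, zt]; ring

/-- The matrix is the square of a symmetric invertible boost. -/
theorem posDef_boostMatrix {α η : ℝ} (hα : 0 < α) (hη : 0 < η) {y : Block d}
    (hy : lorDet y = 1) (hy0 : 0 < y 0 + y 1) : (boostMatrix α η y).PosDef := by
  obtain ⟨r, hr, -, hrr⟩ := exists_boost_sqrt hy hy0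
  refine PosDef.of_dotProduct_mulVec_pos ?_ fun u hu => ?_
  · rw [IsHermitian, conjTranspose_eq_transpose_of_trivial, transpose_boostMatrix]
  · have h1 := hrr √α √η u
    rw [Real.sq_sqrt hα.le, Real.sq_sqrt hη.le] at h1
    rw [boostMatrix_mulVec, ← h1, star_trivial, ← dotProduct_boost_comm]
    have h0 : boost √α √η r u ≠ 0 := fun h0 => hu <| by
      rw [← boost_reflect_boost (Real.sqrt_pos.2 hα).ne' (Real.sqrt_pos.2 hη).ne' hr u, h0,
        map_zero]
    have := dotProduct_star_self_pos_iff.2 h0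
    simpa using this

/-- Quadratic representations act transitively on the vectors of determinant `1`. -/
theorem exists_boost_map {a b : Block d} (ha : lorDet a = 1) (ha0 : 0 < a 0 + a 1)
    (hb : lorDet b = 1) (hb0 : 0 < b 0 + b 1) :
    ∃ z : Block d, lorDet z = 1 ∧ 0 < z 0 + z 1 ∧
      2 * lorInner z a * (z 0 + z 1) - (a 0 + a 1) = b 0 + b 1 ∧
      ∀ i : Fin d, 2 * lorInner z a * z i.succ.succ + a i.succ.succ = b i.succ.succ := by
  have hab : 0 ≤ lorInner a b := by
    have ea := lam2_mul_lam4 (reflect a)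
    have eb := lam2_mul_lam4 b
    have hle := lorInner_le (reflect a) b
    have h1 : lorInner (reflect a) b = 2 * (a 0 + a 1) * (b 0 + b 1) - lorInner a b := by
      simp only [lorInner, reflect_zero_add_one, reflect_tail, neg_mul, Finset.sum_neg_distrib]
      ring
    have e1 : lam2 (reflect a) + lam4 (reflect a) = 2 * (a 0 + a 1) := by
      rw [← reflect_zero_add_one]; unfold lam2 lam4; ring
    have e2 : lam2 b + lam4 b = 2 * (b 0 + b 1) := by unfold lam2 lam4; ring
    rw [lorDet_reflect, ha] at ea
    rw [hb] at eb
    have l1 := lam2_le_lam4 (reflect a)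
    have l2 := lam2_le_lam4 b
    have p1 : 0 < lam2 (reflect a) := by
      by_contra! h
      nlinarith
    have p2 : 0 < lam2 b := by
      by_contra! h
      nlinarith
    have p3 := mul_pos p1 (p2.trans_le l2)
    have p4 := mul_pos (p1.trans_le l1) p2
    nlinarith
  have hk : 0 < 2 * (1 + lorInner a b) := by linarith
  set k := √(2 * (1 + lorInner a b))
  have hk0 : 0 < k := Real.sqrt_pos.2 hk
  have hk2 : k ^ 2 = 2 * (1 + lorInner a b) := Real.sq_sqrt hk.le
  -- On the Lorentz part z is b plus the reflection of a, normalized to determinant 1. Then 2⟨z, a⟩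
  -- = k, so the quadratic representation sends a to kz minus the reflection of a, which is b.
  set z : Block d := mkBlock 0 ((b 0 + b 1 + (a 0 + a 1)) / k)
    (fun i => (b i.succ.succ - a i.succ.succ) / k)
  have zp : z 0 + z 1 = (b 0 + b 1 + (a 0 + a 1)) / k := mkBlock_zero_add_one _ _ _
  have zt : ∀ i : Fin d, z i.succ.succ = (b i.succ.succ - a i.succ.succ) / k := mkBlock_tail _ _ _
  have eab : 2 * ∑ i : Fin d, b i.succ.succ * a i.succ.succ =
      lorInner a b - (a 0 + a 1) * (b 0 + b 1) := by rw [lorInner_comm, lorInner]; ring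
  rw [lorDet] at ha hb
  have hz : lorDet z = 1 := by
    have e : ∑ i : Fin d, z i.succ.succ ^ 2 =
        (∑ i : Fin d, b i.succ.succ ^ 2 - 2 * ∑ i : Fin d, b i.succ.succ * a i.succ.succ
          + ∑ i : Fin d, a i.succ.succ ^ 2) / k ^ 2 := by
      simp only [zt, Finset.mul_sum, ← Finset.sum_sub_distrib, ← Finset.sum_add_distrib,
        Finset.sum_div]
      exact Finset.sum_congr rfl fun i _ => by field_simp; ring
    rw [lorDet, zp, e]
    have hk2' : k ^ 2 ≠ 0 := by positivity
    field_simp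
    linear_combination ha + hb - hk2 + 2 * eab
  have hza : 2 * lorInner z a = k := by
    have e : ∑ i : Fin d, z i.succ.succ * a i.succ.succ =
        (∑ i : Fin d, b i.succ.succ * a i.succ.succ
          - ∑ i : Fin d, a i.succ.succ ^ 2) / k := by
      simp only [zt, ← Finset.sum_sub_distrib, Finset.sum_div]
      exact Finset.sum_congr rfl fun i _ => by field_simp
    rw [lorInner, zp, e]
    field_simp
    linear_combination 2 * ha + 2 * eab - hk2
  refine ⟨z, hz, by rw [zp]; positivity, ?_, fun i => ?_⟩
  · rw [hza, zp]; field_simp; ring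
  · rw [hza, zt]; field_simp; ring

/-- Existence of the Nesterov-Todd scaling of one block. -/
theorem exists_boost_scaling {x s : Block d} (hx : x ∈ interior (cone d))
    (hs : s ∈ interior (cone d)) :
    ∃ (α η : ℝ) (y : Block d), 0 < α ∧ 0 < η ∧ lorDet y = 1 ∧ 0 < y 0 + y 1 ∧
      boost α η y (boost α η y x) = s := by
  rw [mem_interior_cone_iff_lorDet] at hx hs
  obtain ⟨hx1, hx2, hx0⟩ := hx
  obtain ⟨hs1, hs2, hs0⟩ := hs
  set k := √(lorDet x)
  set l := √(lorDet s)
  have hk : 0 < k := Real.sqrt_pos.2 hx2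
  have hl : 0 < l := Real.sqrt_pos.2 hs2
  have hk2 : k ^ 2 = lorDet x := Real.sq_sqrt hx2.le
  have hl2 : l ^ 2 = lorDet s := Real.sq_sqrt hs2.le
  have normalize : ∀ (w : Block d) (c : ℝ), 0 < c → c ^ 2 = lorDet w → 0 < w 0 + w 1 →
      lorDet (c⁻¹ • w) = 1 ∧ 0 < (c⁻¹ • w) 0 + (c⁻¹ • w) 1 := by
    intro w c hc hcw hw
    constructor
    · rw [lorDet_smul, ← hcw, ← mul_pow, inv_mul_cancel₀ hc.ne', one_pow]
    · simp only [Pi.smul_apply, smul_eq_mul, ← mul_add]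
      positivity
  obtain ⟨n1, n2⟩ := normalize x k hk hk2 hx0
  obtain ⟨n3, n4⟩ := normalize s l hl hl2 hs0
  obtain ⟨z, hz, hz0, hzp, hzt⟩ := exists_boost_map n1 n2 n3 n4
  obtain ⟨y, hy, hy0, hyy⟩ := exists_boost_sqrt hz hz0
  -- The boost acts twice, so both factors and the center are square roots of those of the map
  -- taking x to s.
  refine ⟨√(lam1 s / lam1 x), √(l / k), y, by positivity, by positivity, hy, hy0, ?_⟩
  rw [hyy, Real.sq_sqrt (by positivity), Real.sq_sqrt (by positivity)]
  simp only [lorInner_smul_right, Pi.smul_apply, smul_eq_mul] at hzp hzt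
  refine block_ext ?_ ?_ fun i => ?_
  · rw [lam1_boost, div_mul_cancel₀ _ hx1.ne']
  · rw [boost_zero_add_one]
    calc _ = l * (2 * (k⁻¹ * lorInner z x) * (z 0 + z 1) - (k⁻¹ * x 0 + k⁻¹ * x 1)) := by
          field_simp
      _ = _ := by rw [hzp]; field_simp
  · rw [boost_tail]
    calc _ = l * (2 * (k⁻¹ * lorInner z x) * z i.succ.succ + k⁻¹ * x i.succ.succ) := by
          field_simp
      _ = _ := by rw [hzt]; field_simp

/-- The Nesterov-Todd scalings of a single block. -/
def IsBlockScaling (W : Matrix (Fin (d + 2)) (Fin (d + 2)) ℝ) (x s : Block d) : Prop :=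
  W.PosDef ∧ (fun u => W *ᵥ u) '' cone d = cone d ∧ W *ᵥ x = W⁻¹ *ᵥ s

theorem inv_mulVec_mulVec {n : Type*} [Fintype n] [DecidableEq n] {W : Matrix n n ℝ}
    (hW : W.PosDef) (u : n → ℝ) : W⁻¹ *ᵥ (W *ᵥ u) = u := by
  rw [mulVec_mulVec, nonsing_inv_mul _ ((isUnit_iff_isUnit_det W).1 hW.isUnit), one_mulVec]

theorem mulVec_inv_mulVec {n : Type*} [Fintype n] [DecidableEq n] {W : Matrix n n ℝ}
    (hW : W.PosDef) (u : n → ℝ) : W *ᵥ (W⁻¹ *ᵥ u) = u := by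
  rw [mulVec_mulVec, mul_nonsing_inv _ ((isUnit_iff_isUnit_det W).1 hW.isUnit), one_mulVec]

theorem isBlockScaling_boost {x s : Block d} {α η : ℝ} {y : Block d} (hα : 0 < α) (hη : 0 < η)
    (hy : lorDet y = 1) (hy0 : 0 < y 0 + y 1) (h : boost α η y (boost α η y x) = s) :
    IsBlockScaling (boostMatrix α η y) x s := by
  have hpd := posDef_boostMatrix hα hη hy hy0
  refine ⟨hpd, ?_, ?_⟩
  · apply Subset.antisymm
    · rintro _ ⟨u, hu, rfl⟩
      simp only [boostMatrix_mulVec]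
      exact boost_mem_cone hα hη hy hy0 hu
    · intro u hu
      refine ⟨(boostMatrix α η y)⁻¹ *ᵥ u, ?_, mulVec_inv_mulVec hpd u⟩
      rw [inv_boostMatrix hα.ne' hη.ne' hy, boostMatrix_mulVec]
      exact boost_mem_cone (inv_pos.2 hα) (inv_pos.2 hη) (by rwa [lorDet_reflect])
        (by rwa [reflect_zero_add_one]) hu
  · rw [← h, ← boostMatrix_mulVec α η y (boost α η y x), inv_mulVec_mulVec hpd,
      boostMatrix_mulVec]

theorem IsBlockScaling.mulVec_mem {W : Matrix (Fin (d + 2)) (Fin (d + 2)) ℝ} {x s : Block d}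
    (h : IsBlockScaling W x s) {u : Block d} (hu : u ∈ cone d) : W *ᵥ u ∈ cone d :=
  h.2.1 ▸ mem_image_of_mem _ hu

theorem IsBlockScaling.inv_mulVec_mem {W : Matrix (Fin (d + 2)) (Fin (d + 2)) ℝ} {x s : Block d}
    (h : IsBlockScaling W x s) {u : Block d} (hu : u ∈ cone d) : W⁻¹ *ᵥ u ∈ cone d := by
  rw [← h.2.1] at hu
  obtain ⟨w, hw, rfl⟩ := hu
  rwa [inv_mulVec_mulVec h.1]

theorem IsBlockScaling.mulVec_mulVec {W : Matrix (Fin (d + 2)) (Fin (d + 2)) ℝ} {x s : Block d}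
    (h : IsBlockScaling W x s) : W *ᵥ (W *ᵥ x) = s := by
  rw [h.2.2, mulVec_inv_mulVec h.1]

/-- Uniqueness of the Nesterov-Todd scaling of one block. -/
theorem IsBlockScaling.unique {V W : Matrix (Fin (d + 2)) (Fin (d + 2)) ℝ} {x s : Block d}
    (hV : IsBlockScaling V x s) (hW : IsBlockScaling W x s) (hVx : V *ᵥ x ∈ interior (cone d)) :
    W = V := by
  have hVd : IsUnit V.det := (isUnit_iff_isUnit_det V).1 hV.1.isUnit
  have hWd : IsUnit W.det := (isUnit_iff_isUnit_det W).1 hW.1.isUnit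
  have hVi : (V⁻¹)ᴴ = V⁻¹ := hV.1.inv.isHermitian
  have hWh : Wᴴ = W := hW.1.isHermitian
  have hM : (V⁻¹ * (W * W) * V⁻¹).PosDef := by
    have h1 : (W * W).PosDef := by
      have := PosDef.conjTranspose_mul_mul_same (PosDef.one (n := Fin (d + 2)) (R := ℝ))
        (mulVec_injective_iff_isUnit.2 hW.1.isUnit)
      rwa [hWh, mul_one] at this
    have := h1.conjTranspose_mul_mul_same (mulVec_injective_iff_isUnit.2 hV.1.inv.isUnit)
    rwa [hVi] at this
  have hinv : (V⁻¹ * (W * W) * V⁻¹)⁻¹ = V * (W⁻¹ * W⁻¹) * V := by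
    simp only [Matrix.mul_inv_rev, nonsing_inv_nonsing_inv _ hVd, mul_assoc]
  -- This automorphism fixes V x, because W² x = s and V⁻¹ s = V x.
  have hone : V⁻¹ * (W * W) * V⁻¹ = 1 := by
    refine eq_one_of_fixed hM ?_ ?_ hVx ?_
    · intro u hu
      simp only [← Matrix.mulVec_mulVec]
      exact hV.inv_mulVec_mem (hW.mulVec_mem (hW.mulVec_mem (hV.inv_mulVec_mem hu)))
    · intro u hu
      rw [hinv]
      simp only [← Matrix.mulVec_mulVec]
      exact hV.mulVec_mem (hW.inv_mulVec_mem (hW.inv_mulVec_mem (hV.mulVec_mem hu)))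
    · simp only [← Matrix.mulVec_mulVec]
      rw [inv_mulVec_mulVec hV.1, hW.mulVec_mulVec, hV.2.2]
  apply posDef_eq_of_mul_self_eq hW.1 hV.1
  calc W * W = V * (V⁻¹ * (W * W) * V⁻¹) * V := by
        simp only [mul_assoc, nonsing_inv_mul _ hVd, mul_one]
        rw [← mul_assoc V, mul_nonsing_inv _ hVd, one_mul]
    _ = V * V := by rw [hone, mul_one]

/-- The properties of the Nesterov-Todd scaling of one block used in the analysis. -/
theorem IsBlockScaling.exists_similarity {W : Matrix (Fin (d + 2)) (Fin (d + 2)) ℝ}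
    {x s : Block d} (hx : x ∈ interior (cone d)) (hs : s ∈ interior (cone d))
    (hW : IsBlockScaling W x s) :
    ∃ α η : ℝ, 0 < α ∧ 0 < η ∧
      (∀ u, lam1 (W *ᵥ u) = α * lam1 u ∧ lorDet (W *ᵥ u) = η ^ 2 * lorDet u) ∧
      (∀ u, lam1 (W⁻¹ *ᵥ u) = α⁻¹ * lam1 u ∧ lorDet (W⁻¹ *ᵥ u) = η⁻¹ ^ 2 * lorDet u) ∧
      (∀ u ∈ interior (cone d), W *ᵥ u ∈ interior (cone d)) ∧
      (∀ u ∈ interior (cone d), W⁻¹ *ᵥ u ∈ interior (cone d)) := by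
  obtain ⟨α, η, y, hα, hη, hy, hy0, h⟩ := exists_boost_scaling hx hs
  have hV := isBlockScaling_boost hα hη hy hy0 h
  have hint : ∀ u ∈ interior (cone d), boostMatrix α η y *ᵥ u ∈ interior (cone d) := fun u hu => by
    rw [boostMatrix_mulVec]
    exact boost_mem_interior hα hη hy hy0 hu
  -- Uniqueness identifies the given scaling with the explicit boost.
  rw [hV.unique hW (hint x hx)]
  have hy' : lorDet (reflect y) = 1 := by rwa [lorDet_reflect]
  refine ⟨α, η, hα, hη, fun u => ?_, fun u => ?_, hint, fun u hu => ?_⟩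
  · rw [boostMatrix_mulVec, lam1_boost, lorDet_boost _ _ hy]
    exact ⟨rfl, rfl⟩
  · rw [inv_boostMatrix hα.ne' hη.ne' hy, boostMatrix_mulVec, lam1_boost, lorDet_boost _ _ hy']
    exact ⟨rfl, rfl⟩
  · rw [inv_boostMatrix hα.ne' hη.ne' hy, boostMatrix_mulVec]
    exact boost_mem_interior (inv_pos.2 hα) (inv_pos.2 hη) hy'
      (by rwa [reflect_zero_add_one]) hu

theorem exists_isBlockScaling {x s : Block d} (hx : x ∈ interior (cone d))
    (hs : s ∈ interior (cone d)) : ∃ W, IsBlockScaling W x s := by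
  obtain ⟨α, η, y, hα, hη, hy, hy0, h⟩ := exists_boost_scaling hx hs
  exact ⟨_, isBlockScaling_boost hα hη hy hy0 h⟩

theorem IsBlockScaling.eq_one_of_self {W : Matrix (Fin (d + 2)) (Fin (d + 2)) ℝ}
    {x : Block d} (hx : x ∈ interior (cone d)) (hW : IsBlockScaling W x x) : W = 1 := by
  refine IsBlockScaling.unique ⟨PosDef.one, ?_, by simp⟩ hW (by simpa using hx)
  simp

end Block

/-! ### Invariants of the scaled vectors. -/

section BlockScaled

variable {d : ℕ}

/-- The scaled vector of one block. -/
theorem IsBlockScaling.scaled {W : Matrix (Fin (d + 2)) (Fin (d + 2)) ℝ} {x s : Block d}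
    (hx : x ∈ interior (cone d)) (hs : s ∈ interior (cone d)) (hW : IsBlockScaling W x s) :
    W *ᵥ x ∈ interior (cone d) ∧ lam1 (W *ᵥ x) ^ 2 = lam1 x * lam1 s ∧
      lorDet (W *ᵥ x) ^ 2 = lorDet x * lorDet s ∧ (W *ᵥ x) ⬝ᵥ (W *ᵥ x) = x ⬝ᵥ s := by
  obtain ⟨α, η, -, -, h1, -, hint, -⟩ := hW.exists_similarity hx hs
  have hs' := hW.mulVec_mulVec
  have hsymm : Wᵀ = W := by
    have := hW.1.isHermitian.eq
    rwa [conjTranspose_eq_transpose_of_trivial] at this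
  refine ⟨hint x hx, ?_, ?_, ?_⟩
  · rw [← hs', (h1 (W *ᵥ x)).1, (h1 x).1]; ring
  · rw [← hs', (h1 (W *ᵥ x)).2, (h1 x).2]; ring
  · rw [← hs', dotProduct_mulVec x W, ← mulVec_transpose, hsymm]

/-- W and W⁻¹ act by reciprocal factors, so the products of primal and dual invariants do not see
the scaling. This relates the new iterates to their scaled versions. -/
theorem IsBlockScaling.pair {W : Matrix (Fin (d + 2)) (Fin (d + 2)) ℝ} {x s : Block d}
    (hx : x ∈ interior (cone d)) (hs : s ∈ interior (cone d)) (hW : IsBlockScaling W x s)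
    (a b : Block d) :
    lam1 (W⁻¹ *ᵥ a) * lam1 (W *ᵥ b) = lam1 a * lam1 b ∧
      lorDet (W⁻¹ *ᵥ a) * lorDet (W *ᵥ b) = lorDet a * lorDet b ∧
      (W⁻¹ *ᵥ a) ⬝ᵥ (W *ᵥ b) = a ⬝ᵥ b := by
  obtain ⟨α, η, hα, hη, h1, h2, -, -⟩ := hW.exists_similarity hx hs
  have hsymm : Wᵀ = W := by
    have := hW.1.isHermitian.eq
    rwa [conjTranspose_eq_transpose_of_trivial] at this
  refine ⟨?_, ?_, ?_⟩
  · rw [(h1 b).1, (h2 a).1]; field_simp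
  · rw [(h1 b).2, (h2 a).2]; field_simp
  · rw [dotProduct_mulVec, ← mulVec_transpose, hsymm, mulVec_inv_mulVec hW.1]

end BlockScaled

/-! ### Products of cones and the barrier. -/

section Product

variable {N : ℕ} {d : Fin N → ℕ}

theorem vec_ext {x s : Vec d} (h : ∀ j, block x j = block s j) : x = s := by
  funext p
  exact congrFun (h p.1) p.2

theorem continuous_block (j : Fin N) : Continuous fun x : Vec d => block x j := by
  unfold block; fun_prop

theorem block_sub_smul_unitVec (x : Vec d) (r : ℝ) (j : Fin N) :
    block (x - r • unitVec d) j = block x j - r • unitBlock (d j) := rfl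

theorem mem_interior_productCone_iff (x : Vec d) :
    x ∈ interior (productCone d) ↔ ∀ j, block x j ∈ interior (cone (d j)) := by
  constructor
  · intro hx j
    have hcont : ContinuousAt (fun r : ℝ => x - r • unitVec d) 0 := by fun_prop
    have h0 : interior (productCone d) ∈ 𝓝 (x - (0 : ℝ) • unitVec d) := by
      simpa using isOpen_interior.mem_nhds hx
    have hev : ∀ᶠ r : ℝ in 𝓝[>] 0, x - r • unitVec d ∈ interior (productCone d) :=
      (hcont.eventually h0).filter_mono nhdsWithin_le_nhds
    obtain ⟨r, hr, hr0⟩ := (hev.and self_mem_nhdsWithin).exists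
    have hr0 : 0 < r := hr0
    have := (mem_cone_iff _).1 (interior_subset hr j)
    rw [block_sub_smul_unitVec, lam1_sub_smul_unit, lam2_sub_smul_unit] at this
    exact (mem_interior_cone_iff _).2 ⟨by linarith, by linarith⟩
  · intro hx
    refine mem_interior.2 ⟨⋂ j, (fun x : Vec d => block x j) ⁻¹' interior (cone (d j)), ?_, ?_, ?_⟩
    · exact fun y hy j => interior_subset (mem_iInter.1 hy j)
    · exact isOpen_iInter_of_finite fun j => isOpen_interior.preimage (continuous_block j)
    · exact mem_iInter.2 hx

theorem dotProduct_eq_sum_block (x s : Vec d) : x ⬝ᵥ s = ∑ j, block x j ⬝ᵥ block s j := by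
  simp only [dotProduct, Fintype.sum_sigma, block]

theorem block_blockDiagonal'_mulVec (W : Scaling d) (x : Vec d) (j : Fin N) :
    block (blockDiagonal' W *ᵥ x) j = W j *ᵥ block x j := by
  funext i
  simp only [block, mulVec, dotProduct, Fintype.sum_sigma]
  rw [Finset.sum_eq_single j]
  · simp [blockDiagonal'_apply]
  · intro k _ hk
    exact Finset.sum_eq_zero fun l _ => by
      rw [blockDiagonal'_apply_ne _ _ _ hk.symm, zero_mul]
  · simp

theorem IsNTScaling.isBlockScaling {W : Scaling d} {x s : Vec d} (h : IsNTScaling W x s)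
    (j : Fin N) : IsBlockScaling (W j) (block x j) (block s j) := h j

theorem isNTScaling_ntScaling {x s : Vec d} (hx : x ∈ interior (productCone d))
    (hs : s ∈ interior (productCone d)) : IsNTScaling (ntScaling x s) x s := by
  rw [mem_interior_productCone_iff] at hx hs
  choose W hW using fun j => exists_isBlockScaling (hx j) (hs j)
  exact Classical.epsilon_spec (p := fun W => IsNTScaling W x s) ⟨W, hW⟩

theorem inv_ntMatrix {x s : Vec d} (h : IsNTScaling (ntScaling x s) x s) :
    (ntMatrix x s)⁻¹ = blockDiagonal' fun j => (ntScaling x s j)⁻¹ := by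
  refine inv_eq_left_inv ?_
  rw [ntMatrix, ← blockDiagonal'_mul, ← blockDiagonal'_one]
  congr 1
  funext j
  exact nonsing_inv_mul _ ((isUnit_iff_isUnit_det _).1 (h j).1.isUnit)

theorem isUnit_det_ntMatrix {x s : Vec d} (h : IsNTScaling (ntScaling x s) x s) :
    IsUnit (ntMatrix x s).det := by
  have : (blockDiagonal' fun j => (ntScaling x s j)⁻¹) * ntMatrix x s = 1 := by
    rw [ntMatrix, ← blockDiagonal'_mul, ← blockDiagonal'_one]
    congr 1
    funext j
    exact nonsing_inv_mul _ ((isUnit_iff_isUnit_det _).1 (h j).1.isUnit)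
  exact isUnit_det_of_left_inverse this

theorem transpose_ntMatrix {x s : Vec d} (h : IsNTScaling (ntScaling x s) x s) :
    (ntMatrix x s)ᵀ = ntMatrix x s := by
  rw [ntMatrix, blockDiagonal'_transpose]
  congr 1
  funext j
  have := (h j).1.isHermitian.eq
  rwa [conjTranspose_eq_transpose_of_trivial] at this

theorem block_scaledVec (x s : Vec d) (μ : ℝ) (j : Fin N) :
    block (scaledVec x s μ) j = (1 / √μ) • (ntScaling x s j *ᵥ block x j) := by
  rw [← block_blockDiagonal'_mulVec]; rfl

theorem scaledVec_mem_interior {x s : Vec d} (hx : x ∈ interior (productCone d))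
    (hs : s ∈ interior (productCone d)) {μ : ℝ} (hμ : 0 < μ) :
    scaledVec x s μ ∈ interior (productCone d) := by
  have h := isNTScaling_ntScaling hx hs
  rw [mem_interior_productCone_iff] at hx hs ⊢
  intro j
  rw [block_scaledVec]
  exact smul_mem_interior_cone (by positivity) ((h.isBlockScaling j).scaled (hx j) (hs j)).1

theorem ntMatrix_mulVec_scaledVec {x s : Vec d} (h : IsNTScaling (ntScaling x s) x s) {μ : ℝ}
    (hμ : 0 < μ) : √μ • (ntMatrix x s *ᵥ scaledVec x s μ) = s := by
  have hsq : 0 < √μ := Real.sqrt_pos.2 hμ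
  rw [scaledVec, mulVec_smul, smul_smul, mul_one_div_cancel hsq.ne', one_smul]
  refine vec_ext fun j => ?_
  rw [ntMatrix, block_blockDiagonal'_mulVec, block_blockDiagonal'_mulVec]
  exact (h.isBlockScaling j).mulVec_mulVec

theorem inv_ntMatrix_mulVec_scaledVec {x s : Vec d} (h : IsNTScaling (ntScaling x s) x s) {μ : ℝ}
    (hμ : 0 < μ) : √μ • ((ntMatrix x s)⁻¹ *ᵥ scaledVec x s μ) = x := by
  have hsq : 0 < √μ := Real.sqrt_pos.2 hμ
  rw [scaledVec, mulVec_smul, smul_smul, mul_one_div_cancel hsq.ne', one_smul, mulVec_mulVec,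
    nonsing_inv_mul _ (isUnit_det_ntMatrix h), one_mulVec]

theorem barrier_nonneg {ψ : ℝ → ℝ} (h : IsEligibleKernel ψ) {v : Vec d}
    (hv : v ∈ interior (productCone d)) : 0 ≤ barrier ψ v := by
  rw [mem_interior_productCone_iff] at hv
  refine Finset.sum_nonneg fun j _ => ?_
  obtain ⟨h1, h2⟩ := (mem_interior_cone_iff _).1 (hv j)
  rw [jordanTrace_spectralMap]
  have := h.nonneg h1
  have := h.nonneg h2
  have := h.nonneg (h2.trans_le (lam2_le_lam4 _))
  linarith

theorem gradVec_dotProduct_self (ψ : ℝ → ℝ) (v : Vec d) :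
    4 * (gradVec ψ v ⬝ᵥ gradVec ψ v) = ∑ j, (2 * deriv ψ (lam1 (block v j)) ^ 2 +
      deriv ψ (lam2 (block v j)) ^ 2 + deriv ψ (lam4 (block v j)) ^ 2) := by
  rw [dotProduct_eq_sum_block, Finset.mul_sum]
  refine Finset.sum_congr rfl fun j _ => ?_
  rw [show block (gradVec ψ v) j = spectralMap (deriv ψ) (block v j) from rfl,
    dotProduct_self_spectralMap]
  ring

/-- The norm of the gradient `ψ'(v)`. -/
noncomputable def gradNorm (ψ : ℝ → ℝ) (v : Vec d) : ℝ := √(∑ p, gradVec ψ v p ^ 2)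

theorem gradNorm_nonneg (ψ : ℝ → ℝ) (v : Vec d) : 0 ≤ gradNorm ψ v := Real.sqrt_nonneg _

theorem gradNorm_sq (ψ : ℝ → ℝ) (v : Vec d) : gradNorm ψ v ^ 2 = gradVec ψ v ⬝ᵥ gradVec ψ v := by
  rw [gradNorm, Real.sq_sqrt (Finset.sum_nonneg fun _ _ => sq_nonneg _)]
  simp only [dotProduct, sq]

theorem stepSize_eq (ψ : ℝ → ℝ) (v : Vec d) :
    stepSize ψ v = 1 / deriv (deriv ψ) (lowerInv ψ (2 * gradNorm ψ v)) := by
  have : 2 * √2 * proximity ψ v = 2 * gradNorm ψ v := by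
    unfold proximity gradNorm
    have : √2 ≠ 0 := by positivity
    field_simp
  rw [stepSize, this]

/-- Every eigenvalue t has ψ(t) ≤ 2Ψ = ψ(z), the 2 making up for the trace weight 1/2, so
`sq_deriv_mul_le` applies. With weights 2, 1, 1 the values ψ(t) add up to 2Ψ and the ψ'(t)² to four
times the squared gradient norm. -/
theorem deriv_upperInv_le {ψ : ℝ → ℝ} (h : IsEligibleKernel ψ) {v : Vec d}
    (hv : v ∈ interior (productCone d)) (hpos : 0 < barrier ψ v) :
    deriv ψ (upperInv ψ (2 * barrier ψ v)) ≤ 2 * gradNorm ψ v := by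
  rw [mem_interior_productCone_iff] at hv
  have hz := h.one_lt_upperInv (r := 2 * barrier ψ v) (by linarith)
  have hψz := h.map_upperInv (r := 2 * barrier ψ v) (by linarith)
  set z := upperInv ψ (2 * barrier ψ v)
  apply le_of_sq_le_sq _ (by linarith [gradNorm_nonneg ψ v])
  rw [mul_pow, gradNorm_sq, show (2 : ℝ) ^ 2 = 4 by norm_num, gradVec_dotProduct_self]
  have hψ : ∀ j, 0 ≤ ψ (lam1 (block v j)) ∧ 0 ≤ ψ (lam2 (block v j)) ∧
      0 ≤ ψ (lam4 (block v j)) := fun j => by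
    obtain ⟨h1, h2⟩ := (mem_interior_cone_iff _).1 (hv j)
    exact ⟨h.nonneg h1, h.nonneg h2, h.nonneg (h2.trans_le (lam2_le_lam4 _))⟩
  have hb : barrier ψ v = ∑ j, (ψ (lam1 (block v j)) +
      (ψ (lam2 (block v j)) + ψ (lam4 (block v j))) / 2) :=
    Finset.sum_congr rfl fun j _ => jordanTrace_spectralMap _ _
  have hle : ∀ j, ψ (lam1 (block v j)) +
      (ψ (lam2 (block v j)) + ψ (lam4 (block v j))) / 2 ≤ barrier ψ v := fun j => by
    rw [hb]
    refine Finset.single_le_sum (f := fun j => ψ (lam1 (block v j)) +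
      (ψ (lam2 (block v j)) + ψ (lam4 (block v j))) / 2) (fun k _ => ?_) (Finset.mem_univ j)
    obtain ⟨h1, h2, h4⟩ := hψ k
    positivity
  refine le_of_mul_le_mul_right ?_ (by linarith : 0 < 2 * barrier ψ v)
  calc deriv ψ z ^ 2 * (2 * barrier ψ v)
      = ∑ j, (2 * (deriv ψ z ^ 2 * ψ (lam1 (block v j))) +
        deriv ψ z ^ 2 * ψ (lam2 (block v j)) + deriv ψ z ^ 2 * ψ (lam4 (block v j))) := by
        rw [hb, Finset.mul_sum, Finset.mul_sum]
        exact Finset.sum_congr rfl fun j _ => by ring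
    _ ≤ ∑ j, (2 * (deriv ψ (lam1 (block v j)) ^ 2 * ψ z) +
        deriv ψ (lam2 (block v j)) ^ 2 * ψ z + deriv ψ (lam4 (block v j)) ^ 2 * ψ z) := by
        refine Finset.sum_le_sum fun j _ => ?_
        obtain ⟨h1, h2, h4⟩ := hψ j
        obtain ⟨p1, p2⟩ := (mem_interior_cone_iff _).1 (hv j)
        have hj := hle j
        have k1 := h.sq_deriv_mul_le hz p1 (by rw [hψz]; linarith)
        have k2 := h.sq_deriv_mul_le hz p2 (by rw [hψz]; linarith)
        have k4 := h.sq_deriv_mul_le hz (p2.trans_le (lam2_le_lam4 _)) (by rw [hψz]; linarith)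
        linarith
    _ = _ := by
        rw [hψz, Finset.sum_mul]
        exact Finset.sum_congr rfl fun j _ => by ring

/-- At each eigenvalue |ψ'| is at most twice the norm of the gradient. -/
theorem lowerInv_gradNorm_le {ψ : ℝ → ℝ} (h : IsEligibleKernel ψ) {v : Vec d}
    (hv : v ∈ interior (productCone d)) (j : Fin N) :
    lowerInv ψ (gradNorm ψ v) ≤ lam1 (block v j) ∧
      lowerInv ψ (gradNorm ψ v) ≤ lam2 (block v j) := by
  rw [mem_interior_productCone_iff] at hv
  obtain ⟨p1, p2⟩ := (mem_interior_cone_iff _).1 (hv j)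
  have hD := gradNorm_nonneg ψ v
  have hsum : 2 * deriv ψ (lam1 (block v j)) ^ 2 + deriv ψ (lam2 (block v j)) ^ 2 +
      deriv ψ (lam4 (block v j)) ^ 2 ≤ 4 * gradNorm ψ v ^ 2 := by
    rw [gradNorm_sq, gradVec_dotProduct_self]
    exact Finset.single_le_sum (f := fun j => 2 * deriv ψ (lam1 (block v j)) ^ 2 +
      deriv ψ (lam2 (block v j)) ^ 2 + deriv ψ (lam4 (block v j)) ^ 2)
      (fun k _ => by positivity) (Finset.mem_univ j)
  have key : ∀ t, 0 < t → deriv ψ t ^ 2 ≤ 4 * gradNorm ψ v ^ 2 →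
      lowerInv ψ (gradNorm ψ v) ≤ t := fun t ht htD => by
    refine h.lowerInv_le hD ht ?_
    have : deriv ψ t ^ 2 ≤ (2 * gradNorm ψ v) ^ 2 := by rw [mul_pow]; linarith
    exact (abs_le_of_sq_le_sq' this (by linarith)).1
  constructor
  · exact key _ p1 (by
      linarith [sq_nonneg (deriv ψ (lam1 (block v j))), sq_nonneg (deriv ψ (lam2 (block v j))),
        sq_nonneg (deriv ψ (lam4 (block v j)))])
  · exact key _ p2 (by
      linarith [sq_nonneg (deriv ψ (lam1 (block v j))), sq_nonneg (deriv ψ (lam4 (block v j)))])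

theorem dotProduct_block_le (w : Vec d) (j : Fin N) : block w j ⬝ᵥ block w j ≤ w ⬝ᵥ w := by
  rw [dotProduct_eq_sum_block]
  exact Finset.single_le_sum (f := fun j => block w j ⬝ᵥ block w j)
    (fun k _ => Finset.sum_nonneg fun i _ => mul_self_nonneg _) (Finset.mem_univ j)

/-- A scaled step along `w` with `‖w‖ ≤ ‖ψ'(v)‖` keeps the eigenvalues away from zero. -/
theorem lowerInv_le_of_step {ψ : ℝ → ℝ} (h : IsEligibleKernel ψ) {v w : Vec d}
    (hv : v ∈ interior (productCone d)) (hw : w ⬝ᵥ w ≤ gradNorm ψ v ^ 2) (j : Fin N) :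
    lowerInv ψ (2 * gradNorm ψ v) ≤ lam1 (block (v + stepSize ψ v • w) j) ∧
      lowerInv ψ (2 * gradNorm ψ v) ≤ lam2 (block (v + stepSize ψ v • w) j) := by
  have hD := gradNorm_nonneg ψ v
  have hα : 0 ≤ stepSize ψ v := by
    rw [stepSize_eq]
    exact one_div_nonneg.2 (h.deriv2_pos _ (h.lowerInv_mem (by linarith)).1).le
  have hl := lowerInv_gradNorm_le h hv j
  have h2 := h.lowerInv_two_mul_add_le hD
  rw [← stepSize_eq] at h2
  have hb : block (stepSize ψ v • w) j ⬝ᵥ block (stepSize ψ v • w) j ≤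
      (stepSize ψ v * gradNorm ψ v) ^ 2 := by
    refine (dotProduct_block_le _ j).trans ?_
    rw [smul_dotProduct, dotProduct_smul, smul_eq_mul, smul_eq_mul, mul_pow, ← mul_assoc, ← sq]
    exact mul_le_mul_of_nonneg_left hw (sq_nonneg _)
  have k1 := sub_le_lam1_add (mul_nonneg hα hD) (block v j) _ hb
  have k2 := sub_le_lam2_add (mul_nonneg hα hD) (block v j) _ hb
  rw [show block (v + stepSize ψ v • w) j = block v j + block (stepSize ψ v • w) j from rfl]
  exact ⟨by linarith, by linarith⟩

theorem barrier_le_taylor {ψ : ℝ → ℝ} (h : IsEligibleKernel ψ) {l : ℝ} (hl : 0 < l) {v a : Vec d}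
    (hv : ∀ j, l ≤ lam1 (block v j) ∧ l ≤ lam2 (block v j))
    (ha : ∀ j, l ≤ lam1 (block a j) ∧ l ≤ lam2 (block a j)) :
    barrier ψ a ≤ barrier ψ v + 2 * (gradVec ψ v ⬝ᵥ (a - v)) +
      deriv (deriv ψ) l * ((a - v) ⬝ᵥ (a - v)) := by
  rw [dotProduct_eq_sum_block, dotProduct_eq_sum_block, barrier, barrier, Finset.mul_sum,
    Finset.mul_sum, ← Finset.sum_add_distrib, ← Finset.sum_add_distrib]
  exact Finset.sum_le_sum fun j _ =>
    jordanTrace_le_taylor h hl (hv j).1 (hv j).2 (ha j).1 (ha j).2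

/-- Decrease of the mean of the barrier along the scaled search directions. -/
theorem barrier_mean_le {ψ : ℝ → ℝ} (h : IsEligibleKernel ψ) {v dx ds : Vec d}
    (hv : v ∈ interior (productCone d)) (hpos : 0 < barrier ψ v) (horth : dx ⬝ᵥ ds = 0)
    (hsum : dx + ds = -gradVec ψ v) :
    v + stepSize ψ v • dx ∈ interior (productCone d) ∧
      v + stepSize ψ v • ds ∈ interior (productCone d) ∧
      (barrier ψ (v + stepSize ψ v • dx) + barrier ψ (v + stepSize ψ v • ds)) / 2 ≤
        barrier ψ v - decreaseBound ψ (barrier ψ v) := by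
  have hD := gradNorm_nonneg ψ v
  -- Pythagoras: each direction is no longer than the gradient.
  have hn : dx ⬝ᵥ dx + ds ⬝ᵥ ds = gradNorm ψ v ^ 2 := by
    have e : (dx + ds) ⬝ᵥ (dx + ds) = dx ⬝ᵥ dx + ds ⬝ᵥ ds := by
      rw [add_dotProduct, dotProduct_add, dotProduct_add, dotProduct_comm ds dx, horth]; ring
    rw [← e, hsum, neg_dotProduct_neg, gradNorm_sq]
  have hdx : dx ⬝ᵥ dx ≤ gradNorm ψ v ^ 2 := by
    have : 0 ≤ ds ⬝ᵥ ds := Finset.sum_nonneg fun i _ => mul_self_nonneg _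
    linarith
  have hds : ds ⬝ᵥ ds ≤ gradNorm ψ v ^ 2 := by
    have : 0 ≤ dx ⬝ᵥ dx := Finset.sum_nonneg fun i _ => mul_self_nonneg _
    linarith
  have ha := lowerInv_le_of_step h hv hdx
  have hb := lowerInv_le_of_step h hv hds
  have hl : 0 < lowerInv ψ (2 * gradNorm ψ v) := (h.lowerInv_mem (by linarith)).1
  have hv' : ∀ j, lowerInv ψ (2 * gradNorm ψ v) ≤ lam1 (block v j) ∧
      lowerInv ψ (2 * gradNorm ψ v) ≤ lam2 (block v j) := fun j => by
    have h1 := lowerInv_gradNorm_le h hv j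
    have h2 := h.lowerInv_anti hD (by linarith : gradNorm ψ v ≤ 2 * gradNorm ψ v)
    exact ⟨h2.trans h1.1, h2.trans h1.2⟩
  have hint : ∀ a : Vec d, (∀ j, lowerInv ψ (2 * gradNorm ψ v) ≤ lam1 (block a j) ∧
      lowerInv ψ (2 * gradNorm ψ v) ≤ lam2 (block a j)) → a ∈ interior (productCone d) :=
    fun a ha => (mem_interior_productCone_iff a).2 fun j =>
      (mem_interior_cone_iff _).2 ⟨hl.trans_le (ha j).1, hl.trans_le (ha j).2⟩
  refine ⟨hint _ ha, hint _ hb, ?_⟩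
  have ta := barrier_le_taylor h hl hv' ha
  have tb := barrier_le_taylor h hl hv' hb
  simp only [add_sub_cancel_left, smul_dotProduct, dotProduct_smul, smul_eq_mul] at ta tb
  have hg : gradVec ψ v ⬝ᵥ dx + gradVec ψ v ⬝ᵥ ds = -gradNorm ψ v ^ 2 := by
    rw [← dotProduct_add, hsum, dotProduct_neg, gradNorm_sq]
  have hM := h.deriv2_pos _ hl
  have hq := h.deriv_nonneg (h.one_le_upperInv (r := 2 * barrier ψ v) (by linarith))
  have hbound : decreaseBound ψ (barrier ψ v) ≤
      (2 * gradNorm ψ v) ^ 2 / (8 * deriv (deriv ψ) (lowerInv ψ (2 * gradNorm ψ v))) :=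
    h.sq_div_mono hq (deriv_upperInv_le h hv hpos)
  rw [stepSize_eq] at ta tb ⊢
  generalize deriv (deriv ψ) (lowerInv ψ (2 * gradNorm ψ v)) = M at *
  -- With step α = 1/M and D the gradient norm, the mean of the two Taylor bounds drops by αD² -
  -- Mα²D²/2.
  have e : (2 * gradNorm ψ v) ^ 2 / (8 * M) =
      1 / M * gradNorm ψ v ^ 2 - M * (1 / M * (1 / M * gradNorm ψ v ^ 2)) / 2 := by
    field_simp; ring
  rw [e] at hbound
  have e2 : 1 / M * (gradVec ψ v ⬝ᵥ dx) + 1 / M * (gradVec ψ v ⬝ᵥ ds) =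
      -(1 / M * gradNorm ψ v ^ 2) := by rw [← mul_add, hg]; ring
  have e3 : M * (1 / M * (1 / M * (dx ⬝ᵥ dx))) + M * (1 / M * (1 / M * (ds ⬝ᵥ ds))) =
      M * (1 / M * (1 / M * gradNorm ψ v ^ 2)) := by rw [← hn]; ring
  linarith

/-- The barrier at the rescaled new iterate is at most the mean of the barrier values at the
primal and dual scaled steps. -/
theorem centrality_le_mean {ψ : ℝ → ℝ} (h : IsEligibleKernel ψ) {x s a b : Vec d}
    (hx : x ∈ interior (productCone d)) (hs : s ∈ interior (productCone d)) {μ : ℝ} (hμ : 0 < μ)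
    (ha : a ∈ interior (productCone d)) (hb : b ∈ interior (productCone d)) :
    √μ • ((ntMatrix x s)⁻¹ *ᵥ a) ∈ interior (productCone d) ∧
      √μ • (ntMatrix x s *ᵥ b) ∈ interior (productCone d) ∧
      centrality ψ (√μ • ((ntMatrix x s)⁻¹ *ᵥ a)) (√μ • (ntMatrix x s *ᵥ b)) μ ≤
        (barrier ψ a + barrier ψ b) / 2 := by
  have hW := isNTScaling_ntScaling hx hs
  have hsq : 0 < √μ := Real.sqrt_pos.2 hμ
  have ea : ∀ j, block (√μ • ((ntMatrix x s)⁻¹ *ᵥ a)) j =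
      √μ • ((ntScaling x s j)⁻¹ *ᵥ block a j) := fun j => by
    rw [inv_ntMatrix hW]
    exact congrArg (√μ • ·) (block_blockDiagonal'_mulVec (fun j => (ntScaling x s j)⁻¹) a j)
  have eb : ∀ j, block (√μ • (ntMatrix x s *ᵥ b)) j =
      √μ • (ntScaling x s j *ᵥ block b j) := fun j => by
    rw [ntMatrix, ← block_blockDiagonal'_mulVec]; rfl
  rw [mem_interior_productCone_iff] at hx hs ha hb
  have hx' : √μ • ((ntMatrix x s)⁻¹ *ᵥ a) ∈ interior (productCone d) := by
    refine (mem_interior_productCone_iff _).2 fun j => ?_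
    obtain ⟨_, _, _, _, _, _, _, hi⟩ := (hW.isBlockScaling j).exists_similarity (hx j) (hs j)
    rw [ea]
    exact smul_mem_interior_cone hsq (hi _ (ha j))
  have hs' : √μ • (ntMatrix x s *ᵥ b) ∈ interior (productCone d) := by
    refine (mem_interior_productCone_iff _).2 fun j => ?_
    obtain ⟨_, _, _, _, _, _, hi, _⟩ := (hW.isBlockScaling j).exists_similarity (hx j) (hs j)
    rw [eb]
    exact smul_mem_interior_cone hsq (hi _ (hb j))
  refine ⟨hx', hs', ?_⟩
  have hW' := isNTScaling_ntScaling hx' hs'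
  have hv' := scaledVec_mem_interior hx' hs' hμ
  rw [mem_interior_productCone_iff] at hx' hs' hv'
  rw [centrality, barrier, barrier, barrier, ← Finset.sum_add_distrib, Finset.sum_div]
  refine Finset.sum_le_sum fun j _ => ?_
  obtain ⟨-, k1, k2, k3⟩ := (hW'.isBlockScaling j).scaled (hx' j) (hs' j)
  obtain ⟨l1, l2, l3⟩ := (hW.isBlockScaling j).pair (hx j) (hs j) (block a j) (block b j)
  refine jordanTrace_le_mean h (hv' j) (ha j) (hb j) ?_ ?_ ?_
  · rw [block_scaledVec, lam1_smul, mul_pow, k1, ea, eb, lam1_smul, lam1_smul, ← l1]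
    field_simp
  · rw [block_scaledVec, lorDet_smul, mul_pow, k2, ea, eb, lorDet_smul, lorDet_smul, ← l2]
    field_simp
  · rw [block_scaledVec, smul_dotProduct, dotProduct_smul, k3, ea, eb, smul_dotProduct,
      dotProduct_smul, l3]
    simp only [smul_eq_mul]
    field_simp

/-- Effect of one inner iteration. -/
theorem centrality_step_le {ψ : ℝ → ℝ} (h : IsEligibleKernel ψ) {x s dx ds : Vec d}
    (hx : x ∈ interior (productCone d)) (hs : s ∈ interior (productCone d)) {μ : ℝ} (hμ : 0 < μ)
    (hpos : 0 < centrality ψ x s μ) (horth : dx ⬝ᵥ ds = 0)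
    (hsum : dx + ds = -gradVec ψ (scaledVec x s μ)) {x' s' : Vec d}
    (hx' : x' = x + stepSize ψ (scaledVec x s μ) • (√μ • ((ntMatrix x s)⁻¹ *ᵥ dx)))
    (hs' : s' = s + stepSize ψ (scaledVec x s μ) • (√μ • (ntMatrix x s *ᵥ ds))) :
    x' ∈ interior (productCone d) ∧ s' ∈ interior (productCone d) ∧
      centrality ψ x' s' μ ≤ centrality ψ x s μ - decreaseBound ψ (centrality ψ x s μ) := by
  have hv := scaledVec_mem_interior hx hs hμ
  have hW := isNTScaling_ntScaling hx hs
  obtain ⟨ha, hb, hle⟩ := barrier_mean_le h hv hpos horth hsum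
  obtain ⟨k1, k2, k3⟩ := centrality_le_mean h hx hs hμ ha hb
  have ex : √μ • ((ntMatrix x s)⁻¹ *ᵥ (scaledVec x s μ +
      stepSize ψ (scaledVec x s μ) • dx)) = x' := by
    rw [mulVec_add, smul_add, inv_ntMatrix_mulVec_scaledVec hW hμ, mulVec_smul, smul_comm, hx']
  have es : √μ • (ntMatrix x s *ᵥ (scaledVec x s μ +
      stepSize ψ (scaledVec x s μ) • ds)) = s' := by
    rw [mulVec_add, smul_add, ntMatrix_mulVec_scaledVec hW hμ, mulVec_smul, smul_comm, hs']
  rw [ex] at k1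
  rw [es] at k2
  rw [ex, es] at k3
  exact ⟨k1, k2, k3.trans hle⟩

/-- Growth of the barrier when `v` is scaled up. -/
theorem barrier_smul_le {ψ : ℝ → ℝ} (h : IsEligibleKernel ψ) (hN : 0 < N) {v : Vec d}
    (hv : v ∈ interior (productCone d)) {τ β : ℝ} (hτ : 0 < τ) (hβ : 1 < β)
    (hvτ : barrier ψ v ≤ τ) :
    barrier ψ (β • v) ≤ 2 * N * ψ (β * upperInv ψ (τ / (2 * N))) := by
  have hN' : (0 : ℝ) < N := Nat.cast_pos.2 hN
  have hr : 0 < τ / (2 * N) := by positivity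
  have hz := h.one_lt_upperInv hr
  have hψz := h.map_upperInv hr.le
  set z := upperInv ψ (τ / (2 * N))
  have hβ0 : 0 < β := by linarith
  have hβz : 1 < β * z := by nlinarith
  have hK : 0 ≤ β * deriv ψ (β * z) / deriv ψ z :=
    div_nonneg (mul_nonneg hβ0.le (h.deriv_pos hβz).le) (h.deriv_pos hz).le
  have key : ∀ t : ℝ, 0 < t → ψ (β * t) ≤
      ψ (β * z) + β * deriv ψ (β * z) / deriv ψ z * (ψ t - ψ z) :=
    fun t ht => h.map_mul_le hz hβ ht
  set K := β * deriv ψ (β * z) / deriv ψ z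
  rw [mem_interior_productCone_iff] at hv
  -- The scalar bound is affine in ψ(t) and the trace weights of a block add up to 2. As 2Nψ(z) = τ
  -- and the barrier is at most τ, the terms with K have a nonpositive sum.
  have hsum : barrier ψ (β • v) ≤
      ∑ j : Fin N, (2 * (ψ (β * z) - K * ψ z) + K * jordanTrace (spectralMap ψ (block v j))) := by
    refine Finset.sum_le_sum fun j _ => ?_
    obtain ⟨p1, p2⟩ := (mem_interior_cone_iff _).1 (hv j)
    rw [show block (β • v) j = β • block v j from rfl, jordanTrace_spectralMap,
      jordanTrace_spectralMap, lam1_smul, lam2_smul hβ0.le, lam4_smul hβ0.le]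
    have k1 := key _ p1
    have k2 := key _ p2
    have k4 := key _ (p2.trans_le (lam2_le_lam4 _))
    linarith
  rw [Finset.sum_add_distrib, ← Finset.mul_sum, ← Finset.mul_sum, Finset.sum_const,
    Finset.card_univ, Fintype.card_fin, nsmul_eq_mul, ← barrier.eq_def, hψz] at hsum
  have e : (N : ℝ) * (2 * (K * (τ / (2 * N)))) = K * τ := by field_simp
  have := mul_le_mul_of_nonneg_left hvτ hK
  linarith

/-- The scaling matrix does not depend on μ, so an update only multiplies v by 1/√(1-θ). -/
theorem centrality_update_le {ψ : ℝ → ℝ} (h : IsEligibleKernel ψ) (hN : 0 < N) {x s : Vec d}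
    (hx : x ∈ interior (productCone d)) (hs : s ∈ interior (productCone d)) {μ τ θ : ℝ}
    (hμ : 0 < μ) (hτ : 0 < τ) (hθ : 0 < θ) (hθ1 : θ < 1) (hle : centrality ψ x s μ ≤ τ) :
    centrality ψ x s ((1 - θ) * μ) ≤ 2 * N * ψ (upperInv ψ (τ / (2 * N)) / √(1 - θ)) := by
  have h1 : 0 < 1 - θ := by linarith
  have hsq : 0 < √(1 - θ) := Real.sqrt_pos.2 h1
  have hβ : 1 < 1 / √(1 - θ) := by
    rw [lt_div_iff₀ hsq, one_mul, Real.sqrt_lt' one_pos]; linarith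
  have e : scaledVec x s ((1 - θ) * μ) = (1 / √(1 - θ)) • scaledVec x s μ := by
    rw [scaledVec, scaledVec, smul_smul, Real.sqrt_mul h1.le]
    congr 1
    rw [one_div_mul_one_div]
  have := barrier_smul_le h hN (scaledVec_mem_interior hx hs hμ) hτ hβ hle
  rw [centrality, e]
  rwa [one_div_mul_eq_div] at this

theorem unitVec_mem_interior : unitVec d ∈ interior (productCone d) := by
  refine (mem_interior_productCone_iff _).2 fun j => (mem_interior_cone_iff _).2 ?_
  have e : block (unitVec d) j = unitBlock (d j) := rfl
  rw [e]
  constructor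
  · simp [lam1, unitBlock]
  · simp [lam2, tailNorm, unitBlock]

/-- By uniqueness the scaling of (e, e) is the identity, and all eigenvalues of e are 1. -/
theorem centrality_unitVec {ψ : ℝ → ℝ} (h : IsEligibleKernel ψ) :
    centrality ψ (unitVec d) (unitVec d) 1 = 0 := by
  have hu := unitVec_mem_interior (d := d)
  have hW := isNTScaling_ntScaling hu hu
  rw [centrality, barrier]
  refine Finset.sum_eq_zero fun j _ => ?_
  rw [block_scaledVec, (hW.isBlockScaling j).eq_one_of_self
    ((mem_interior_productCone_iff _).1 hu j), one_mulVec, Real.sqrt_one, div_one, one_smul,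
    show block (unitVec d) j = unitBlock (d j) from rfl, jordanTrace_spectralMap]
  have h1 : lam1 (unitBlock (d j)) = 1 := by simp [lam1, unitBlock]
  have h2 : lam2 (unitBlock (d j)) = 1 := by simp [lam2, tailNorm, unitBlock]
  have h4 : lam4 (unitBlock (d j)) = 1 := by simp [lam4, tailNorm, unitBlock]
  rw [h1, h2, h4, h.map_one]
  ring

end Product

/-! ### Search directions. -/

section Direction

theorem transpose_mulVec_injective {m : ℕ} {ι : Type*} [Fintype ι] [DecidableEq ι]
    {A : Matrix (Fin m) ι ℝ} (hA : A.rank = m) : Function.Injective fun y => Aᵀ *ᵥ y := by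
  have h1 : Module.finrank ℝ (LinearMap.range Aᵀ.mulVecLin) = m :=
    (rank_transpose A).trans hA
  have h2 := LinearMap.finrank_range_add_finrank_ker Aᵀ.mulVecLin
  rw [h1, Module.finrank_fin_fun, Nat.add_eq_left, Submodule.finrank_eq_zero] at h2
  exact LinearMap.ker_eq_bot.1 h2

/-- Orthogonal decomposition of `-g` along the kernel of `P` and the range of `Pᵀ`. -/
theorem existsUnique_direction {m : ℕ} {ι : Type*} [Fintype ι] [DecidableEq ι]
    {P : Matrix (Fin m) ι ℝ} (hP : Function.Injective fun y => Pᵀ *ᵥ y) (g : ι → ℝ) :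
    ∃! q : (ι → ℝ) × (Fin m → ℝ) × (ι → ℝ),
      P *ᵥ q.1 = 0 ∧ Pᵀ *ᵥ q.2.1 + q.2.2 = 0 ∧ q.1 + q.2.2 = -g := by
  have hinj : Function.Injective fun y => (P * Pᵀ) *ᵥ y := by
    intro y z hyz
    have h0 : (P * Pᵀ) *ᵥ (y - z) = 0 := by
      rw [mulVec_sub, sub_eq_zero]; exact hyz
    have h1 : (Pᵀ *ᵥ (y - z)) ⬝ᵥ (Pᵀ *ᵥ (y - z)) = 0 := by
      rw [dotProduct_mulVec, ← mulVec_transpose, transpose_transpose, mulVec_mulVec, h0,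
        zero_dotProduct]
    have h2 : Pᵀ *ᵥ (y - z) = 0 := dotProduct_self_eq_zero.1 h1
    rw [mulVec_sub, sub_eq_zero] at h2
    exact hP h2
  have hu : IsUnit (P * Pᵀ).det :=
    (isUnit_iff_isUnit_det _).1 (mulVec_injective_iff_isUnit.1 hinj)
  refine ⟨(-g + Pᵀ *ᵥ ((P * Pᵀ)⁻¹ *ᵥ (P *ᵥ g)), (P * Pᵀ)⁻¹ *ᵥ (P *ᵥ g),
    -(Pᵀ *ᵥ ((P * Pᵀ)⁻¹ *ᵥ (P *ᵥ g)))), ⟨?_, ?_, ?_⟩, ?_⟩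
  · simp only [mulVec_add, mulVec_neg]
    rw [mulVec_mulVec _ P Pᵀ, mulVec_mulVec _ (P * Pᵀ), mul_nonsing_inv _ hu, one_mulVec,
      neg_add_cancel]
  · simp
  · simp
  · rintro ⟨dx, dy, ds⟩ ⟨h1, h2, h3⟩
    simp only at h1 h2 h3
    have hds : ds = -(Pᵀ *ᵥ dy) := (neg_eq_of_add_eq_zero_right h2).symm
    have hdx : dx = -g + Pᵀ *ᵥ dy := by
      rw [← h3, hds]; abel
    have hdy : dy = (P * Pᵀ)⁻¹ *ᵥ (P *ᵥ g) := by
      rw [hdx, mulVec_add, mulVec_neg, mulVec_mulVec, neg_add_eq_zero] at h1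
      rw [h1, mulVec_mulVec, nonsing_inv_mul _ hu, one_mulVec]
    rw [hds, hdx, hdy]

end Direction

section Direction

variable {N m : ℕ} {d : Fin N → ℕ} {A : Matrix (Fin m) (Σ j : Fin N, Fin (d j + 2)) ℝ}
  {ψ : ℝ → ℝ} {x s dx ds : Vec d} {dy : Fin m → ℝ} {μ : ℝ}

theorem existsUnique_isScaledDirection (hA : A.rank = m) (hx : x ∈ interior (productCone d))
    (hs : s ∈ interior (productCone d)) (hμ : 0 < μ) :
    ∃! q : Vec d × (Fin m → ℝ) × Vec d, IsScaledDirection A ψ x s μ q.1 q.2.1 q.2.2 := by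
  have hW := isNTScaling_ntScaling hx hs
  have hsq : 0 < √μ := Real.sqrt_pos.2 hμ
  refine existsUnique_direction (fun y z hyz => transpose_mulVec_injective hA ?_) _
  have hdet := isUnit_det_ntMatrix hW
  simp only [transpose_smul, transpose_mul, smul_mulVec, transpose_nonsing_inv,
    transpose_ntMatrix hW] at hyz
  have h1 := smul_right_injective _ (one_div_pos.2 hsq).ne' hyz
  have h2 := congrArg (ntMatrix x s *ᵥ ·) h1
  simpa only [← mulVec_mulVec, mulVec_mulVec _ (ntMatrix x s), mul_nonsing_inv _ hdet,
    ← Matrix.mul_assoc, one_mulVec] using h2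

/-- The kernel of a matrix is orthogonal to its row space. -/
theorem IsScaledDirection.orthogonal (h : IsScaledDirection A ψ x s μ dx dy ds) :
    dx ⬝ᵥ ds = 0 := by
  obtain ⟨h1, h2, -⟩ := h
  rw [← neg_eq_of_add_eq_zero_right h2, dotProduct_neg, dotProduct_mulVec, ← mulVec_transpose,
    transpose_transpose, h1, zero_dotProduct, neg_zero]

theorem IsScaledDirection.primal (h : IsScaledDirection A ψ x s μ dx dy ds) (hμ : 0 < μ) (α : ℝ) :
    A *ᵥ (x + α • (√μ • ((ntMatrix x s)⁻¹ *ᵥ dx))) = A *ᵥ x := by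
  have hsq : 0 < √μ := Real.sqrt_pos.2 hμ
  have h1 := h.1
  rw [smul_mulVec, ← mulVec_mulVec] at h1
  have h2 := (smul_eq_zero.1 h1).resolve_left (one_div_pos.2 hsq).ne'
  rw [mulVec_add, mulVec_smul, mulVec_smul, h2, smul_zero, smul_zero, add_zero]

theorem IsScaledDirection.dual (h : IsScaledDirection A ψ x s μ dx dy ds) (hμ : 0 < μ)
    (hW : IsNTScaling (ntScaling x s) x s) (y : Fin m → ℝ) (α : ℝ) :
    Aᵀ *ᵥ (y + α • dy) + (s + α • (√μ • (ntMatrix x s *ᵥ ds))) = Aᵀ *ᵥ y + s := by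
  have hsq : 0 < √μ := Real.sqrt_pos.2 hμ
  have hds : √μ • (ntMatrix x s *ᵥ ds) = -(Aᵀ *ᵥ dy) := by
    rw [← neg_eq_of_add_eq_zero_right h.2.1, transpose_smul, transpose_mul, transpose_nonsing_inv,
      transpose_ntMatrix hW, mulVec_neg, smul_mulVec, mulVec_smul, smul_neg, smul_smul,
      mul_one_div_cancel hsq.ne', one_smul, mulVec_mulVec, ← Matrix.mul_assoc,
      mul_nonsing_inv _ (isUnit_det_ntMatrix hW), Matrix.one_mul]
  rw [hds, mulVec_add, mulVec_smul, smul_neg]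
  abel

end Direction

/-! ### Arithmetic of the iteration counts. -/

section Counting

/-- A decrease by `κ t^(1-γ)` decreases `t^γ` by at least `κ γ`. -/
theorem rpow_add_le_of_decrease {κ γ t t' : ℝ} (hγ : 0 < γ) (hγ1 : γ ≤ 1)
    (ht : 0 < t) (ht' : 0 ≤ t') (h : t' ≤ t - κ * t ^ (1 - γ)) :
    t' ^ γ + κ * γ ≤ t ^ γ := by
  have htγ : 0 < t ^ γ := Real.rpow_pos_of_pos ht γ
  have e : t ^ (1 - γ) = t / t ^ γ := by rw [Real.rpow_sub ht, Real.rpow_one]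
  have h1 : t' ≤ t * (1 + -(κ / t ^ γ)) := by
    rw [e] at h
    calc t' ≤ _ := h
      _ = _ := by ring
  have h2 : 0 ≤ 1 + -(κ / t ^ γ) := by
    by_contra! hneg
    exact absurd (ht'.trans h1) (not_le.2 (mul_neg_of_pos_of_neg ht hneg))
  calc t' ^ γ + κ * γ ≤ (t * (1 + -(κ / t ^ γ))) ^ γ + κ * γ := by
        gcongr
    _ = t ^ γ * (1 + -(κ / t ^ γ)) ^ γ + κ * γ := by rw [Real.mul_rpow ht.le h2]
    _ ≤ t ^ γ * (1 + γ * -(κ / t ^ γ)) + κ * γ := by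
        gcongr
        -- Bernoulli's inequality for exponents in [0, 1].
        exact rpow_one_add_le_one_add_mul_self (by linarith) hγ.le hγ1
    _ = t ^ γ := by field_simp; ring

theorem mul_neg_log_le {ε M θ : ℝ} (hε : 0 < ε) (hM : 0 < M) (hθ1 : θ < 1) {k : ℕ}
    (h : ε ≤ M * (1 - θ) ^ k) : k * -Real.log (1 - θ) ≤ Real.log (M / ε) := by
  have h1 : 0 < 1 - θ := by linarith
  have := Real.log_le_log hε h
  rw [Real.log_mul hM.ne' (pow_pos h1 k).ne', Real.log_pow] at this
  rw [Real.log_div hM.ne' hε.ne']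
  linarith

/-- Here k counts the updates before the latest one. The strict inequality -log(1-θ) > θ gives k <
l/θ and so pays for the extra 1; for k = 0 this is the positivity of l. -/
theorem succ_le_ceil {θ l : ℝ} (hθ : 0 < θ) (hθ1 : θ < 1) (hl : 0 < l) {k : ℕ}
    (h : k * -Real.log (1 - θ) ≤ l) : k + 1 ≤ ⌈1 / θ * l⌉₊ := by
  rw [Nat.succ_le_iff, Nat.lt_ceil, one_div_mul_eq_div, lt_div_iff₀ hθ]
  rcases Nat.eq_zero_or_pos k with rfl | hk
  · simpa using hl
  · have h1 := Real.log_lt_sub_one_of_pos (by linarith : 0 < 1 - θ) (by linarith)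
    have hk' : (0 : ℝ) < k := Nat.cast_pos.2 hk
    exact (mul_lt_mul_of_pos_left (by linarith) hk').trans_le h

/-- The sharper bound -log(1-θ) ≥ 2θ/(2-θ) gives k ≤ l/θ - l/2, and l ≥ 2 absorbs the extra 1
without a ceiling. This is where the condition ε ≤ 3N/e² comes from. -/
theorem succ_le_div {θ l : ℝ} (hθ : 0 < θ) (hθ1 : θ < 1) (hl : 2 ≤ l) {k : ℕ}
    (h : k * -Real.log (1 - θ) ≤ l) : (k : ℝ) + 1 ≤ l / θ := by
  have h1 : 0 < 1 - θ := by linarith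
  have hlog : 2 * θ / (2 - θ) ≤ -Real.log (1 - θ) := by
    have := Real.le_log_one_add_of_nonneg (x := θ / (1 - θ)) (by positivity)
    rw [show 1 + θ / (1 - θ) = (1 - θ)⁻¹ by field_simp; ring, Real.log_inv] at this
    refine le_trans (le_of_eq ?_) this
    have : 2 - θ ≠ 0 := by linarith
    have : θ / (1 - θ) + 2 ≠ 0 := by positivity
    field_simp
    ring
  have h2 := (mul_le_mul_of_nonneg_left hlog (Nat.cast_nonneg k)).trans h
  rw [← mul_div_assoc, div_le_iff₀ (by linarith)] at h2
  rw [le_div_iff₀ hθ]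
  nlinarith

end Counting

/-! ### The run of the algorithm. -/

section Run

variable {N m : ℕ} {d : Fin N → ℕ}

/-- What holds in every state of the run; `L` bounds the barrier after an update of `μ`. -/
structure RunInvariant (A : Matrix (Fin m) (Σ j : Fin N, Fin (d j + 2)) ℝ) (b : Fin m → ℝ)
    (c : Vec d) (ψ : ℝ → ℝ) (τ ε θ κ γ L : ℝ) (st : State m d) : Prop where
  feasible : StrictlyFeasible A b c st.x st.y st.s
  mu_eq : st.μ = (1 - θ) ^ st.outer
  outer_test : ∀ k, st.outer = k + 1 → ε ≤ 3 * N * (1 - θ) ^ k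
  outside : st.inLoop = false → centrality ψ st.x st.s st.μ ≤ τ ∧
    κ * γ * st.inner ≤ L ^ γ ∧ κ * γ * st.total ≤ st.outer * L ^ γ
  inside : st.inLoop = true → κ * γ * st.inner + centrality ψ st.x st.s st.μ ^ γ ≤ L ^ γ ∧
    κ * γ * st.total + centrality ψ st.x st.s st.μ ^ γ ≤ st.outer * L ^ γ

variable {A : Matrix (Fin m) (Σ j : Fin N, Fin (d j + 2)) ℝ} {b : Fin m → ℝ} {c : Vec d}
  {ψ : ℝ → ℝ} {τ ε θ κ γ L : ℝ} {st st' : State m d}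

theorem RunInvariant.mu_pos (h : RunInvariant A b c ψ τ ε θ κ γ L st) (hθ1 : θ < 1) :
    0 < st.μ := by
  rw [h.mu_eq]
  exact pow_pos (by linarith) _

theorem RunInvariant.centrality_nonneg (h : RunInvariant A b c ψ τ ε θ κ γ L st)
    (hψ : IsEligibleKernel ψ) (hθ1 : θ < 1) : 0 ≤ centrality ψ st.x st.s st.μ :=
  barrier_nonneg hψ (scaledVec_mem_interior h.feasible.2.1 h.feasible.2.2.2 (h.mu_pos hθ1))

theorem RunInvariant.inner_le (h : RunInvariant A b c ψ τ ε θ κ γ L st)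
    (hψ : IsEligibleKernel ψ) (hθ1 : θ < 1) : κ * γ * st.inner ≤ L ^ γ := by
  have := Real.rpow_nonneg (h.centrality_nonneg hψ hθ1) γ
  rcases hloc : st.inLoop with _ | _
  · exact (h.outside hloc).2.1
  · linarith [(h.inside hloc).1]

theorem RunInvariant.total_le (h : RunInvariant A b c ψ τ ε θ κ γ L st)
    (hψ : IsEligibleKernel ψ) (hθ1 : θ < 1) : κ * γ * st.total ≤ st.outer * L ^ γ := by
  have := Real.rpow_nonneg (h.centrality_nonneg hψ hθ1) γ
  rcases hloc : st.inLoop with _ | _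
  · exact (h.outside hloc).2.2
  · linarith [(h.inside hloc).2]

theorem runInvariant_initial {y₀ : Fin m → ℝ} (hψ : IsEligibleKernel ψ)
    (hb : A *ᵥ unitVec d = b) (hc : Aᵀ *ᵥ y₀ + unitVec d = c) (hτ : 0 ≤ τ) (hL : 0 ≤ L) :
    RunInvariant A b c ψ τ ε θ κ γ L (initial d y₀) where
  feasible := ⟨hb, unitVec_mem_interior, hc, unitVec_mem_interior⟩
  mu_eq := by simp [initial]
  outer_test k hk := by simp [initial] at hk
  outside _ := by
    refine ⟨(centrality_unitVec hψ).trans_le hτ, ?_, ?_⟩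
    · simpa [initial] using Real.rpow_nonneg hL γ
    · simp [initial]
  inside h := by simp [initial] at h

/-- The hypotheses on the parameters, with `L` the bound on the barrier after an update. -/
structure Parameters (d : Fin N → ℕ) (ψ : ℝ → ℝ) (τ θ κ γ L : ℝ) : Prop where
  kernel : IsEligibleKernel ψ
  dim_pos : 0 < N
  tau_pos : 0 < τ
  theta_pos : 0 < θ
  theta_lt : θ < 1
  gamma_pos : 0 < γ
  gamma_le : γ ≤ 1
  growth : ∀ v ∈ interior (productCone d), τ < barrier ψ v →
    κ * barrier ψ v ^ (1 - γ) ≤ decreaseBound ψ (barrier ψ v)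
  bound : L = 2 * N * ψ (upperInv ψ (τ / (2 * N)) / √(1 - θ))

theorem RunInvariant.step (hp : Parameters d ψ τ θ κ γ L)
    (h : RunInvariant A b c ψ τ ε θ κ γ L st) (hst : Step A ψ τ ε θ st st') :
    RunInvariant A b c ψ τ ε θ κ γ L st' := by
  have hμ := h.mu_pos hp.theta_lt
  obtain ⟨hpr, hx, hdu, hs⟩ := h.feasible
  cases hst with
  | update hloc htest =>
    obtain ⟨k1, k2, k3⟩ := h.outside hloc
    have hle := centrality_update_le hp.kernel hp.dim_pos hx hs hμ hp.tau_pos hp.theta_pos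
      hp.theta_lt k1
    rw [← hp.bound] at hle
    have hnn : 0 ≤ centrality ψ st.x st.s ((1 - θ) * st.μ) := barrier_nonneg hp.kernel
      (scaledVec_mem_interior hx hs (mul_pos (by linarith [hp.theta_lt]) hμ))
    have hpow := Real.rpow_le_rpow hnn hle hp.gamma_pos.le
    refine ⟨h.feasible, ?_, ?_, ?_, ?_⟩
    · simp only [h.mu_eq, pow_succ']
    · intro k hk
      have hk : st.outer = k := by simpa using hk
      rw [← hk, ← h.mu_eq]
      exact htest
    · intro hf; simp at hf
    -- The inner counter is reset, and the budget for all inner iterations grows by L^γ, which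
    -- covers the new value of Φ^γ.
    · intro _
      push_cast
      constructor
      · simpa using hpow
      · linarith
  | leave hloc hΦ =>
    obtain ⟨k1, k2⟩ := h.inside hloc
    exact ⟨h.feasible, h.mu_eq, h.outer_test,
      fun _ => ⟨hΦ, h.inner_le hp.kernel hp.theta_lt, h.total_le hp.kernel hp.theta_lt⟩,
      fun hf => by simp at hf⟩
  | move hloc hΦ dx dy ds hdir =>
    obtain ⟨k1, k2⟩ := h.inside hloc
    have hW := isNTScaling_ntScaling hx hs
    have hpos : 0 < centrality ψ st.x st.s st.μ := hp.tau_pos.trans hΦ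
    obtain ⟨hx', hs', hdec⟩ := centrality_step_le hp.kernel hx hs hμ hpos hdir.orthogonal
      hdir.2.2 rfl rfl
    have hgr := hp.growth _ (scaledVec_mem_interior hx hs hμ) hΦ
    have hnn := barrier_nonneg hp.kernel (scaledVec_mem_interior hx' hs' hμ)
    have hpow := rpow_add_le_of_decrease hp.gamma_pos hp.gamma_le hpos hnn
      (hdec.trans (sub_le_sub_left hgr _))
    rw [← centrality.eq_def] at hpow
    refine ⟨⟨?_, hx', ?_, hs'⟩, h.mu_eq, h.outer_test, ?_, ?_⟩
    · rw [hdir.primal hμ, hpr]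
    · rw [hdir.dual hμ hW, hdu]
    · intro hf; simp [hloc] at hf
    · intro _
      push_cast
      constructor <;> linarith

theorem Reachable.runInvariant {y₀ : Fin m → ℝ} (hp : Parameters d ψ τ θ κ γ L) (hL : 0 ≤ L)
    (hb : A *ᵥ unitVec d = b) (hc : Aᵀ *ᵥ y₀ + unitVec d = c)
    (h : Reachable A ψ τ ε θ y₀ st) : RunInvariant A b c ψ τ ε θ κ γ L st := by
  induction h with
  | refl => exact runInvariant_initial hp.kernel hb hc hp.tau_pos.le hL
  | tail _ hst ih => exact ih.step hp hst

/-- The guards exclude each other and exhaust all cases except the return; the only apparent choice,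
the search direction, is unique. -/
theorem RunInvariant.progress (hA : A.rank = m) (hθ1 : θ < 1)
    (h : RunInvariant A b c ψ τ ε θ κ γ L st) :
    Returns ε st ∨ ∃! st' : State m d, Step A ψ τ ε θ st st' := by
  rcases hloc : st.inLoop with _ | _
  · rcases lt_or_ge (3 * N * st.μ) ε with hμ | hμ
    · exact Or.inl ⟨hloc, hμ⟩
    · refine Or.inr ⟨_, Step.update st hloc hμ, fun st' hst' => ?_⟩
      cases hst' with
      | update => rfl
      | move h' => simp [hloc] at h'
      | leave h' => simp [hloc] at h'
  · right
    rcases le_or_gt (centrality ψ st.x st.s st.μ) τ with hΦ | hΦ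
    · refine ⟨_, Step.leave st hloc hΦ, fun st' hst' => ?_⟩
      cases hst' with
      | update h' => simp [hloc] at h'
      | move _ h' => exact absurd h' (not_lt.2 hΦ)
      | leave => rfl
    · obtain ⟨⟨dx, dy, ds⟩, hq, huniq⟩ := existsUnique_isScaledDirection (ψ := ψ) hA
        h.feasible.2.1 h.feasible.2.2.2 (h.mu_pos hθ1)
      refine ⟨_, Step.move st hloc hΦ dx dy ds hq, fun st' hst' => ?_⟩
      cases hst' with
      | update h' => simp [hloc] at h'
      | move _ _ dx' dy' ds' hdir =>
        have := huniq (dx', dy', ds') hdir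
        simp only [Prod.mk.injEq] at this
        obtain ⟨rfl, rfl, rfl⟩ := this
        rfl
      | leave _ h' => exact absurd hΦ (not_lt.2 h')

/-- A quantity that every step increases by one. -/
def State.clock (st : State m d) : ℕ := 2 * st.outer + st.total + if st.inLoop then 0 else 1

theorem Step.clock_eq (h : Step A ψ τ ε θ st st') : st'.clock = st.clock + 1 := by
  cases h with
  | update hloc => simp [State.clock, hloc]; ring
  | move hloc => simp [State.clock, hloc]; ring
  | leave hloc => simp [State.clock, hloc]

/-- A run that never returns would make the clock arbitrarily large, whereas the bounds on the
counters keep it at most 2B + C + 1. -/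
theorem exists_reachable_returns {y₀ : Fin m → ℝ} {B C : ℕ}
    (hprog : ∀ st : State m d, Reachable A ψ τ ε θ y₀ st →
      Returns ε st ∨ ∃ st' : State m d, Step A ψ τ ε θ st st')
    (hbound : ∀ st : State m d, Reachable A ψ τ ε θ y₀ st → st.outer ≤ B ∧ st.total ≤ C) :
    ∃ st : State m d, Reachable A ψ τ ε θ y₀ st ∧ Returns ε st := by
  by_contra! hcon
  have key : ∀ n : ℕ, ∃ st : State m d, Reachable A ψ τ ε θ y₀ st ∧ n ≤ st.clock := by
    intro n
    induction n with
    | zero => exact ⟨_, Relation.ReflTransGen.refl, Nat.zero_le _⟩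
    | succ n ih =>
      obtain ⟨st, hr, hn⟩ := ih
      obtain ⟨st', hst'⟩ := (hprog st hr).resolve_left (hcon st hr)
      exact ⟨st', hr.tail hst', by rw [hst'.clock_eq]; omega⟩
  obtain ⟨st, hr, hn⟩ := key (2 * B + C + 2)
  obtain ⟨h1, h2⟩ := hbound st hr
  unfold State.clock at hn
  split_ifs at hn <;> omega

end Run

end TypeTwoSOCO

/-! ### The main theorem. -/

theorem mainTheorem1 {N m : ℕ} (d : Fin N → ℕ)
    (A : Matrix (Fin m) (Σ j : Fin N, Fin (d j + 2)) ℝ) (b : Fin m → ℝ) (c : Vec d)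
    (y₀ : Fin m → ℝ)
    (hA : A.rank = m) (hb : A *ᵥ unitVec d = b)
    (hc : Aᵀ *ᵥ y₀ + unitVec d = c)
    (ψ : ℝ → ℝ) (hψ : IsEligibleKernel ψ)
    (τ ε θ κ γ : ℝ) (hτ : 1 < τ) (hε : 0 < ε) (hεN : ε < 3 * N)
    (hθ : 0 < θ) (hθ1 : θ < 1) (hκ : 0 < κ) (hγ : 0 < γ) (hγ1 : γ ≤ 1)
    (hgrowth : ∀ v ∈ interior (productCone d), τ < barrier ψ v →
      κ * barrier ψ v ^ (1 - γ) ≤ decreaseBound ψ (barrier ψ v)) :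
    -- the algorithm is well defined: every state of the run that does not return has exactly
    -- one successor
    (∀ st : State m d, Reachable A ψ τ ε θ y₀ st →
      StrictlyFeasible A b c st.x st.y st.s ∧
      IsNTScaling (ntScaling st.x st.s) st.x st.s ∧
      (Returns ε st ∨ ∃! st' : State m d, Step A ψ τ ε θ st st')) ∧
    -- the algorithm returns, and what it returns is accurate
    (∃ st : State m d, Reachable A ψ τ ε θ y₀ st ∧ Returns ε st) ∧
    (∀ st : State m d, Reachable A ψ τ ε θ y₀ st → Returns ε st →
      IsAccurate A b c ψ τ ε st.μ st.x st.y st.s) ∧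
    -- iteration bounds, valid throughout the run
    (∀ st : State m d, Reachable A ψ τ ε θ y₀ st →
      (st.inner : ℝ) ≤
        (2 * N * ψ (upperInv ψ (τ / (2 * N)) / √(1 - θ))) ^ γ / (κ * γ) ∧
      st.outer ≤ ⌈1 / θ * Real.log (3 * N / ε)⌉₊ ∧
      (st.total : ℝ) ≤
        (2 * N * ψ (upperInv ψ (τ / (2 * N)) / √(1 - θ))) ^ γ / (κ * γ) *
          ⌈1 / θ * Real.log (3 * N / ε)⌉₊ ∧
      (ε ≤ 3 * N / Real.exp 2 →
        (st.total : ℝ) ≤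
          1 / (θ * κ * γ) * (2 * N * ψ (upperInv ψ (τ / (2 * N)) / √(1 - θ))) ^ γ *
            Real.log (3 * N / ε))) := by
  have hM : (0 : ℝ) < 3 * N := hε.trans hεN
  have hN : 0 < N := Nat.pos_of_ne_zero fun h => by simp [h] at hM
  have hτ0 : 0 < τ := zero_lt_one.trans hτ
  have hθ1' : 0 < 1 - θ := by linarith
  have hp : Parameters d ψ τ θ κ γ (2 * N * ψ (upperInv ψ (τ / (2 * N)) / √(1 - θ))) :=
    ⟨hψ, hN, hτ0, hθ, hθ1, hγ, hγ1, hgrowth, rfl⟩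
  have hL : 0 ≤ 2 * N * ψ (upperInv ψ (τ / (2 * N)) / √(1 - θ)) := by
    have h1 := hψ.one_le_upperInv (r := τ / (2 * N)) (by positivity)
    have h2 := hψ.nonneg (t := upperInv ψ (τ / (2 * N)) / √(1 - θ))
      (div_pos (by linarith) (Real.sqrt_pos.2 hθ1'))
    positivity
  generalize 2 * N * ψ (upperInv ψ (τ / (2 * N)) / √(1 - θ)) = L at *
  have hinv : ∀ st : State m d, Reachable A ψ τ ε θ y₀ st →
      RunInvariant A b c ψ τ ε θ κ γ L st := fun st h => h.runInvariant hp hL hb hc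
  have hLγ : 0 ≤ L ^ γ := Real.rpow_nonneg hL γ
  have hκγ : 0 < κ * γ := mul_pos hκ hγ
  have hlog : 0 < Real.log (3 * N / ε) := Real.log_pos ((one_lt_div hε).2 hεN)
  have houter : ∀ st : State m d, Reachable A ψ τ ε θ y₀ st →
      st.outer ≤ ⌈1 / θ * Real.log (3 * N / ε)⌉₊ := by
    intro st hst
    rcases hk : st.outer with _ | k
    · exact Nat.zero_le _
    · exact succ_le_ceil hθ hθ1 hlog
        (mul_neg_log_le hε hM hθ1 ((hinv st hst).outer_test k hk))
  have htotal : ∀ st : State m d, Reachable A ψ τ ε θ y₀ st →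
      (st.total : ℝ) ≤ L ^ γ / (κ * γ) * ⌈1 / θ * Real.log (3 * N / ε)⌉₊ := by
    intro st hst
    have h1 := (hinv st hst).total_le hψ hθ1
    have h2 := mul_le_mul_of_nonneg_right (Nat.cast_le (α := ℝ).2 (houter st hst)) hLγ
    rw [div_mul_eq_mul_div, le_div_iff₀ hκγ]
    linarith
  refine ⟨fun st hst => ⟨(hinv st hst).feasible,
    isNTScaling_ntScaling (hinv st hst).feasible.2.1 (hinv st hst).feasible.2.2.2,
    (hinv st hst).progress hA hθ1⟩, ?_, ?_, ?_⟩
  · refine exists_reachable_returns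
      (fun st hst => ((hinv st hst).progress hA hθ1).imp_right ExistsUnique.exists)
      (fun st hst => ⟨houter st hst, Nat.le_floor (htotal st hst)⟩)
  · exact fun st hst hret => ⟨(hinv st hst).feasible, (hinv st hst).mu_pos hθ1, hret.2,
      ((hinv st hst).outside hret.1).1⟩
  · intro st hst
    refine ⟨?_, houter st hst, htotal st hst, fun hε2 => ?_⟩
    · have := (hinv st hst).inner_le hψ hθ1
      rw [le_div_iff₀ hκγ]
      linarith
    · have hl2 : 2 ≤ Real.log (3 * N / ε) := by
        rw [Real.le_log_iff_exp_le (div_pos hM hε), le_div_iff₀ hε]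
        rw [le_div_iff₀ (Real.exp_pos 2)] at hε2
        linarith
      have hout : (st.outer : ℝ) ≤ Real.log (3 * N / ε) / θ := by
        rcases hk : st.outer with _ | k
        · simpa using div_nonneg hlog.le hθ.le
        · push_cast
          exact succ_le_div hθ hθ1 hl2
            (mul_neg_log_le hε hM hθ1 ((hinv st hst).outer_test k hk))
      have h1 := (hinv st hst).total_le hψ hθ1
      have h2 := mul_le_mul_of_nonneg_right hout hLγ
      have e : 1 / (θ * κ * γ) * L ^ γ * Real.log (3 * N / ε) =
          Real.log (3 * N / ε) / θ * L ^ γ / (κ * γ) := by field_simp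
      rw [e, le_div_iff₀ hκγ]
      linarith
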